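/- Let $\mathcal{O}_2$ be the Cuntz algebra on two generators, that is, the universal unital C*-algebra generated by two isometries $S_1, S_2$ with $S_1S_1^*+S_2S_2^*=1$. Let $\sigma$ be the *-automorphism of $\mathcal{O}_2$ with $\sigma(S_1)=S_2$ and $\sigma(S_2)=S_1$. Let $\mathcal{O}_2\rtimes_\sigma\mathbb{Z}$ be the C*-crossed product, that is, the universal C*-algebra generated by a copy of $\mathcal{O}_2$ and a unitary $U$ such that $UaU^*=\sigma(a)$ for all $a\in\mathcal{O}_2$. Call $a\in\mathcal{O}_2$ symmetric if $a=\sigma(a)$ and antisymmetric if $a=-\sigma(a)$. Then the set $$\left\{ f\in C([-1,1],\mathcal{O}_2) \;:\; f(1)+f(-1)\text{ is symmetric and } f(1)-f(-1)\text{ is antisymmetric}\right\}$$ is a unital *-subalgebra of $C([-1,1],\mathcal{O}_2)$ (with pointwise operations), and it is *-isomorphic to $\mathcal{O}_2\rtimes_\sigma\mathbb{Z}$. -/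

import Mathlib

open scoped ENNReal

universe u

noncomputable section

/-! ### The universal C*-algebra on a set of generators subject to relations -/

/-- Relations on a family of generators indexed by `X`: a predicate which says which families of
elements of unital C*-algebras satisfy the relations. So that there is a universal C*-algebra, the
relations have to bound the norm of each generator. -/
structure CStarRelations (X : Type u) where
  Holds : (B : Type u) → [CStarAlgebra B] → (X → B) → Prop
  bound : X → ℝ
  norm_le : ∀ (B : Type u) [CStarAlgebra B] [Nontrivial B] (f : X → B), Holds B f →
    ∀ x, ‖f x‖ ≤ bound x

namespace CStarRelations

/-- The value at a family `f` of a noncommutative polynomial in the generators and their adjoints: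
`Sum.inl x` stands for the generator `x` and `Sum.inr x` for its adjoint. -/
def evalAt {X : Type u} {B : Type u} [CStarAlgebra B] (f : X → B) :
    FreeAlgebra ℂ (X ⊕ X) →ₐ[ℂ] B :=
  FreeAlgebra.lift ℂ (Sum.elim f fun x => star (f x))

variable {X : Type u} (R : CStarRelations X)

/-- A realization of the relations in a nonzero unital C*-algebra. -/
structure Realization where
  carrier : Type u
  [cstar : CStarAlgebra carrier]
  [nontriv : Nontrivial carrier]
  gen : X → carrier
  holds : R.Holds carrier gen

attribute [instance] Realization.cstar Realization.nontriv

/-- The C*-seminorm on noncommutative polynomials defined by a realization. -/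
def Realization.seminorm {R : CStarRelations X} (ρ : R.Realization) :
    FreeAlgebra ℂ (X ⊕ X) → ℝ :=
  fun p => ‖evalAt ρ.gen p‖

/-- The set (it is small) of all C*-seminorms that come from realizations of the relations. -/
def Index : Type u := Set.range fun ρ : R.Realization => ρ.seminorm

/-- A realization that induces the given C*-seminorm. -/
def rep (i : R.Index) : R.Realization := i.2.choose

theorem seminorm_rep (i : R.Index) : (R.rep i).seminorm = i.1 := i.2.choose_spec

/-- The bounded product of one realization for each C*-seminorm. -/
abbrev Prod : Type u := lp (fun i : R.Index => (R.rep i).carrier) ∞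

instance instCStarAlgebraProd : CStarAlgebra R.Prod where

/-- The tautological family in the product. -/
def prodGen (x : X) : R.Prod :=
  ⟨fun i => (R.rep i).gen x, memℓp_infty ⟨R.bound x, by
    rintro _ ⟨i, rfl⟩
    exact R.norm_le _ _ (R.rep i).holds x⟩⟩

/-- The closed star subalgebra of the product that the tautological family generates. -/
def closedSubalgebra : StarSubalgebra ℂ R.Prod :=
  (StarAlgebra.adjoin ℂ (Set.range R.prodGen)).topologicalClosure

instance isClosed_closedSubalgebra : IsClosed (R.closedSubalgebra : Set R.Prod) :=
  StarSubalgebra.isClosed_topologicalClosure _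

/-- The universal unital C*-algebra on generators `X` subject to the relations `R`: the completion
of the noncommutative star polynomials in the largest C*-seminorm coming from a realization. -/
def Universal : Type u := R.closedSubalgebra

instance instCStarAlgebraUniversal : CStarAlgebra R.Universal :=
  inferInstanceAs (CStarAlgebra R.closedSubalgebra)

/-- The canonical generators of the universal C*-algebra. -/
def gen (x : X) : R.Universal :=
  ⟨R.prodGen x, StarSubalgebra.le_topologicalClosure _
    (StarAlgebra.subset_adjoin ℂ _ (Set.mem_range_self x))⟩

/-- The inclusion of the universal C*-algebra into the product of realizations. -/
def incl : R.Universal →⋆ₐ[ℂ] R.Prod := R.closedSubalgebra.subtype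

theorem incl_injective : Function.Injective R.incl := Subtype.val_injective

theorem norm_incl (a : R.Universal) : ‖R.incl a‖ = ‖a‖ := rfl

theorem incl_gen (x : X) : R.incl (R.gen x) = R.prodGen x := rfl

/-- The coordinate of the product at `i`. -/
def coord (i : R.Index) : R.Prod →⋆ₐ[ℂ] (R.rep i).carrier where
  toFun a := a i
  map_one' := rfl
  map_mul' _ _ := rfl
  map_zero' := rfl
  map_add' _ _ := rfl
  commutes' _ := rfl
  map_star' _ := rfl

theorem coord_incl_gen (i : R.Index) (x : X) :
    R.coord i (R.incl (R.gen x)) = (R.rep i).gen x := rfl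

theorem ext_coord {a b : R.Universal}
    (h : ∀ i, R.coord i (R.incl a) = R.coord i (R.incl b)) : a = b :=
  R.incl_injective (lp.ext (funext h))

theorem map_evalAt {B C : Type u} [CStarAlgebra B] [CStarAlgebra C] (φ : B →⋆ₐ[ℂ] C) (f : X → B)
    (p : FreeAlgebra ℂ (X ⊕ X)) : φ (evalAt f p) = evalAt (fun x => φ (f x)) p := by
  have : (φ : B →ₐ[ℂ] C).comp (evalAt f) = evalAt (fun x => φ (f x)) := by
    apply FreeAlgebra.hom_ext
    funext x
    rcases x with x | x <;> simp [evalAt, map_star]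
  exact DFunLike.congr_fun this p

/-- Each realization has norm at most that of the universal C*-algebra. -/
theorem norm_evalAt_le {B : Type u} [CStarAlgebra B] (f : X → B) (hf : R.Holds B f)
    (p : FreeAlgebra ℂ (X ⊕ X)) : ‖evalAt f p‖ ≤ 1 * ‖evalAt R.gen p‖ := by
  rw [one_mul]
  rcases subsingleton_or_nontrivial B with h | h
  · rw [Subsingleton.elim (evalAt f p) 0, norm_zero]; exact norm_nonneg _
  let ρ : R.Realization := ⟨B, f, hf⟩
  let i : R.Index := ⟨ρ.seminorm, ρ, rfl⟩
  have h1 : ‖evalAt f p‖ = ‖evalAt (R.rep i).gen p‖ := (congrFun (R.seminorm_rep i) p).symm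
  have h2 : evalAt (R.rep i).gen p = R.coord i (R.incl (evalAt R.gen p)) := by
    rw [map_evalAt, map_evalAt]; rfl
  rw [h1, h2, ← R.norm_incl]
  exact lp.norm_apply_le_norm (by simp) _ i

theorem exists_evalAt_star (p : FreeAlgebra ℂ (X ⊕ X)) :
    ∃ q : FreeAlgebra ℂ (X ⊕ X), ∀ (B : Type u) [CStarAlgebra B] (f : X → B),
      evalAt f q = star (evalAt f p) := by
  induction p using FreeAlgebra.induction with
  | grade0 c =>
    refine ⟨algebraMap ℂ _ (star c), fun B _ f => ?_⟩
    rw [AlgHom.commutes, AlgHom.commutes, algebraMap_star_comm]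
  | grade1 x =>
    rcases x with x | x
    · exact ⟨FreeAlgebra.ι ℂ (Sum.inr x), fun B _ f => by simp [evalAt]⟩
    · exact ⟨FreeAlgebra.ι ℂ (Sum.inl x), fun B _ f => by simp [evalAt]⟩
  | mul a b ha hb =>
    obtain ⟨a', ha'⟩ := ha
    obtain ⟨b', hb'⟩ := hb
    exact ⟨b' * a', fun B _ f => by rw [map_mul, map_mul, star_mul, ha', hb']⟩
  | add a b ha hb =>
    obtain ⟨a', ha'⟩ := ha
    obtain ⟨b', hb'⟩ := hb
    exact ⟨a' + b', fun B _ f => by rw [map_add, map_add, star_add, ha', hb']⟩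

/-- The star polynomials in the generators are dense. -/
theorem denseRange_evalAt_gen : DenseRange (evalAt R.gen) := by
  intro a
  have hrange : (StarAlgebra.adjoin ℂ (Set.range R.prodGen) : Set R.Prod) =
      Set.range (evalAt R.prodGen) := by
    have h : (StarAlgebra.adjoin ℂ (Set.range R.prodGen)).toSubalgebra =
        (evalAt R.prodGen).range := by
      rw [StarAlgebra.adjoin_toSubalgebra, evalAt, ← Algebra.adjoin_range_eq_range_freeAlgebra_lift,
        Set.Sum.elim_range]
      congr 2
      ext y
      simp only [Set.mem_star, Set.mem_range]
      exact ⟨fun ⟨x, hx⟩ => ⟨x, by rw [hx, star_star]⟩, fun ⟨x, hx⟩ => ⟨x, by rw [← hx, star_star]⟩⟩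
    exact congrArg (fun S : Subalgebra ℂ R.Prod => (S : Set R.Prod)) h
  have ha : R.incl a ∈ closure (Set.range (evalAt R.prodGen)) := by
    rw [← hrange, ← StarSubalgebra.topologicalClosure_coe]
    exact a.2
  rw [Metric.mem_closure_iff] at ha ⊢
  intro ε hε
  obtain ⟨_, ⟨p, rfl⟩, hp⟩ := ha ε hε
  refine ⟨_, ⟨p, rfl⟩, ?_⟩
  have h2 : R.incl (evalAt R.gen p) = evalAt R.prodGen p := by rw [map_evalAt]; rfl
  rw [← h2] at hp
  exact hp

/-- The continuous linear map underlying the homomorphism that a realization induces. -/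
def liftCLM {B : Type u} [CStarAlgebra B] (f : X → B) : R.Universal →L[ℂ] B :=
  (evalAt f).toLinearMap.extendOfNorm (evalAt R.gen).toLinearMap

theorem liftCLM_evalAt {B : Type u} [CStarAlgebra B] (f : X → B) (hf : R.Holds B f)
    (p : FreeAlgebra ℂ (X ⊕ X)) : R.liftCLM f (evalAt R.gen p) = evalAt f p :=
  LinearMap.extendOfNorm_eq (f := (evalAt f).toLinearMap) (e := (evalAt R.gen).toLinearMap)
    R.denseRange_evalAt_gen ⟨1, R.norm_evalAt_le f hf⟩ p

/-- The homomorphism from the universal C*-algebra that a realization induces. -/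
def lift {B : Type u} [CStarAlgebra B] (f : X → B) (hf : R.Holds B f) : R.Universal →⋆ₐ[ℂ] B where
  toFun := R.liftCLM f
  map_one' := by simpa using R.liftCLM_evalAt f hf 1
  map_mul' a b := by
    refine R.denseRange_evalAt_gen.induction_on₂
      (p := fun a b => R.liftCLM f (a * b) = R.liftCLM f a * R.liftCLM f b)
      (isClosed_eq (by fun_prop) (by fun_prop)) (fun p q => ?_) a b
    rw [← map_mul, R.liftCLM_evalAt f hf, R.liftCLM_evalAt f hf, R.liftCLM_evalAt f hf, map_mul]
  map_zero' := map_zero _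
  map_add' := map_add _
  commutes' c := by
    have h := R.liftCLM_evalAt f hf (algebraMap ℂ _ c)
    rwa [AlgHom.commutes, AlgHom.commutes] at h
  map_star' a := by
    refine R.denseRange_evalAt_gen.induction_on
      (p := fun a => R.liftCLM f (star a) = star (R.liftCLM f a)) a
      (isClosed_eq (by fun_prop) (by fun_prop)) (fun p => ?_)
    obtain ⟨q, hq⟩ := exists_evalAt_star p
    rw [← hq, R.liftCLM_evalAt f hf, R.liftCLM_evalAt f hf, hq]

theorem lift_gen {B : Type u} [CStarAlgebra B] (f : X → B) (hf : R.Holds B f) (x : X) :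
    R.lift f hf (R.gen x) = f x := by
  have h := R.liftCLM_evalAt f hf (FreeAlgebra.ι ℂ (Sum.inl x))
  have h1 : R.liftCLM f (R.gen x) = f x := by simpa [evalAt] using h
  exact h1

/-- A homomorphism from the universal C*-algebra is determined by its values on generators. -/
theorem hom_ext {B : Type u} [CStarAlgebra B] {φ ψ : R.Universal →⋆ₐ[ℂ] B}
    (h : ∀ x, φ (R.gen x) = ψ (R.gen x)) : φ = ψ := by
  have hφ : Continuous φ := AddMonoidHomClass.continuous_of_bound φ 1 fun a => by
    rw [one_mul]; exact NonUnitalStarAlgHom.norm_apply_le φ a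
  have hψ : Continuous ψ := AddMonoidHomClass.continuous_of_bound ψ 1 fun a => by
    rw [one_mul]; exact NonUnitalStarAlgHom.norm_apply_le ψ a
  refine DFunLike.ext' (R.denseRange_evalAt_gen.equalizer hφ hψ (funext fun p => ?_))
  simp only [Function.comp_apply]
  rw [map_evalAt, map_evalAt]
  simp_rw [h]

end CStarRelations

/-! ### The Cuntz algebra on two generators and the automorphism exchanging its generators -/

/-- Two isometries with `S₁ S₁* + S₂ S₂* = 1`. -/
structure IsCuntzPair {B : Type u} [CStarAlgebra B] (S₁ S₂ : B) : Prop where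
  isometry₁ : star S₁ * S₁ = 1
  isometry₂ : star S₂ * S₂ = 1
  sum_eq_one : S₁ * star S₁ + S₂ * star S₂ = 1

theorem norm_le_one_of_star_mul_self {B : Type u} [CStarAlgebra B] [Nontrivial B] {S : B}
    (h : star S * S = 1) : ‖S‖ ≤ 1 := by
  have h1 : ‖S‖ * ‖S‖ = 1 := by rw [← CStarRing.norm_star_mul_self, h, CStarRing.norm_one]
  nlinarith [norm_nonneg S]

/-- The Cuntz relation on two generators. -/
def cuntzRelations : CStarRelations (Fin 2) where
  Holds _ _ f := IsCuntzPair (f 0) (f 1)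
  bound _ := 1
  norm_le B _ _ f hf x := by
    fin_cases x
    · exact norm_le_one_of_star_mul_self hf.isometry₁
    · exact norm_le_one_of_star_mul_self hf.isometry₂

/-- The Cuntz algebra `𝒪₂`: the universal unital C*-algebra generated by two isometries
`S₁`, `S₂` with `S₁ S₁* + S₂ S₂* = 1`. -/
abbrev CuntzAlgebraTwo : Type := cuntzRelations.Universal

namespace CuntzAlgebraTwo

/-- The first canonical isometry. -/
def S₁ : CuntzAlgebraTwo := cuntzRelations.gen 0

/-- The second canonical isometry. -/
def S₂ : CuntzAlgebraTwo := cuntzRelations.gen 1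

theorem isCuntzPair : IsCuntzPair S₁ S₂ where
  isometry₁ := cuntzRelations.ext_coord fun i => by
    simp only [map_mul, map_star, map_one]
    exact (cuntzRelations.rep i).holds.isometry₁
  isometry₂ := cuntzRelations.ext_coord fun i => by
    simp only [map_mul, map_star, map_one]
    exact (cuntzRelations.rep i).holds.isometry₂
  sum_eq_one := cuntzRelations.ext_coord fun i => by
    simp only [map_mul, map_star, map_one, map_add]
    exact (cuntzRelations.rep i).holds.sum_eq_one

theorem isCuntzPair_swap : IsCuntzPair S₂ S₁ :=
  ⟨isCuntzPair.isometry₂, isCuntzPair.isometry₁, by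
    rw [add_comm]; exact isCuntzPair.sum_eq_one⟩

/-- The endomorphism of `𝒪₂` that exchanges the canonical isometries. -/
def swapHom : CuntzAlgebraTwo →⋆ₐ[ℂ] CuntzAlgebraTwo :=
  cuntzRelations.lift ![S₂, S₁] isCuntzPair_swap

theorem swapHom_S₁ : swapHom S₁ = S₂ := cuntzRelations.lift_gen _ _ 0

theorem swapHom_S₂ : swapHom S₂ = S₁ := cuntzRelations.lift_gen _ _ 1

theorem swapHom_swapHom (a : CuntzAlgebraTwo) : swapHom (swapHom a) = a := by
  have h : swapHom.comp swapHom = StarAlgHom.id ℂ CuntzAlgebraTwo := by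
    refine cuntzRelations.hom_ext fun x => ?_
    fin_cases x
    · exact (congrArg swapHom swapHom_S₁).trans swapHom_S₂
    · exact (congrArg swapHom swapHom_S₂).trans swapHom_S₁
  exact DFunLike.congr_fun h a

/-- The order two automorphism `σ` of `𝒪₂` with `σ S₁ = S₂` and `σ S₂ = S₁`. -/
def σ : CuntzAlgebraTwo ≃⋆ₐ[ℂ] CuntzAlgebraTwo :=
  StarAlgEquiv.ofStarAlgHom swapHom swapHom
    (StarAlgHom.ext swapHom_swapHom) (StarAlgHom.ext swapHom_swapHom)

theorem σ_S₁ : σ S₁ = S₂ := swapHom_S₁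

theorem σ_S₂ : σ S₂ = S₁ := swapHom_S₂

theorem σ_σ (a : CuntzAlgebraTwo) : σ (σ a) = a := swapHom_swapHom a

/-- An element of `𝒪₂` is symmetric when `σ` fixes it. -/
def IsSymmetric (a : CuntzAlgebraTwo) : Prop := a = σ a

/-- An element of `𝒪₂` is antisymmetric when `σ` changes its sign. -/
def IsAntisymmetric (a : CuntzAlgebraTwo) : Prop := a = -σ a

end CuntzAlgebraTwo

/-! ### The crossed product by an action of the integers -/

/-- The relations of the crossed product of a unital C*-algebra `A` by the action of `ℤ` that an
automorphism `α` generates. The generators are the elements of `A` (as `Sum.inl a`) and one more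
element `U` (as `Sum.inr ()`); the relations say that `a ↦ Sum.inl a` is a unital
star homomorphism, that `U` is unitary, and that `U a U* = α a` for all `a` in `A`. -/
def crossedProductRelations (A : Type u) [CStarAlgebra A] (α : A ≃⋆ₐ[ℂ] A) :
    CStarRelations (A ⊕ PUnit.{u + 1}) where
  Holds B _ f := ∃ (π : A →⋆ₐ[ℂ] B) (U : B),
    (∀ a, f (Sum.inl a) = π a) ∧ f (Sum.inr PUnit.unit) = U ∧
      U ∈ unitary B ∧ ∀ a, U * π a * star U = π (α a)
  bound := Sum.elim (fun a => ‖a‖) fun _ => 1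
  norm_le B _ _ f hf x := by
    obtain ⟨π, U, hπ, hU, hun, -⟩ := hf
    rcases x with a | ⟨⟩
    · rw [hπ]; exact NonUnitalStarAlgHom.norm_apply_le π a
    · rw [hU]; exact norm_le_one_of_star_mul_self hun.1

/-- The C*-crossed product `A ⋊_α ℤ`: the universal C*-algebra generated by a copy of `A` and a
unitary `U` with `U a U* = α a` for all `a` in `A`. -/
abbrev CrossedProductInt (A : Type u) [CStarAlgebra A] (α : A ≃⋆ₐ[ℂ] A) : Type u :=
  (crossedProductRelations A α).Universal

/-! ### Continuous functions with symmetric and antisymmetric endpoint combinations -/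

namespace CuntzAlgebraTwo

/-- The right endpoint of `[-1, 1]`. -/
def rightEnd : Set.Icc (-1 : ℝ) 1 := ⟨1, by norm_num, le_refl _⟩

/-- The left endpoint of `[-1, 1]`. -/
def leftEnd : Set.Icc (-1 : ℝ) 1 := ⟨-1, le_refl _, by norm_num⟩

theorem endpoint_iff (x y : CuntzAlgebraTwo) :
    (IsSymmetric (x + y) ∧ IsAntisymmetric (x - y)) ↔ y = σ x := by
  unfold IsSymmetric IsAntisymmetric
  constructor
  · rintro ⟨h1, h2⟩
    rw [map_add] at h1
    rw [map_sub] at h2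
    have h3 : (2 : ℂ) • y = (2 : ℂ) • σ x := by
      rw [two_smul, two_smul]
      calc y + y = (x + y) - (x - y) := by abel
        _ = (σ x + σ y) - -(σ x - σ y) := by rw [← h1, ← h2]
        _ = σ x + σ x := by abel
    exact smul_right_injective _ (two_ne_zero) h3
  · rintro rfl
    rw [map_add, map_sub, σ_σ]
    exact ⟨add_comm _ _, by abel⟩

/-- The C*-algebra, with pointwise operations and the supremum norm, of the continuous functions
`f : [-1, 1] → 𝒪₂` such that `f 1 + f (-1)` is symmetric and `f 1 - f (-1)` is antisymmetric. -/
def endpointAlgebra : StarSubalgebra ℂ C(Set.Icc (-1 : ℝ) 1, CuntzAlgebraTwo) where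
  carrier := {f | IsSymmetric (f rightEnd + f leftEnd) ∧ IsAntisymmetric (f rightEnd - f leftEnd)}
  mul_mem' {f g} hf hg := by
    simp only [Set.mem_ofPred_eq, endpoint_iff] at hf hg ⊢
    rw [ContinuousMap.mul_apply, ContinuousMap.mul_apply, hf, hg, map_mul]
  add_mem' {f g} hf hg := by
    simp only [Set.mem_ofPred_eq, endpoint_iff] at hf hg ⊢
    rw [ContinuousMap.add_apply, ContinuousMap.add_apply, hf, hg, map_add]
  algebraMap_mem' c := by
    simp only [Set.mem_ofPred_eq, endpoint_iff]
    exact (AlgHomClass.commutes σ c).symm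
  star_mem' {f} hf := by
    simp only [Set.mem_ofPred_eq, endpoint_iff] at hf ⊢
    rw [ContinuousMap.star_apply, ContinuousMap.star_apply, hf, map_star]

end CuntzAlgebraTwo

end

noncomputable section

/-! ### Partitions of unity and commuting convex combinations -/

/-! The endpoint conditions say exactly that `f (-1) = σ (f 1)`. The isomorphism rests on a
description of `𝒪₂` as a crossed product of itself by an order two action. Put `u = S₁S₁* - S₂S₂*`,
a self-adjoint unitary with `σ u = -u`. The fixed point algebra of `σ` is again a copy of `𝒪₂`,
embedded by `fixedHom`, and conjugation by `u` acts on this copy as `σ`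
(`flipUnitary_mul_fixedHom`). Averaging with `σ` splits every element uniquely as `fixedHom a + u *
fixedHom b`.

On the side of the crossed product, `σ² = 1` makes `U²` central. It therefore suffices to consider
sums `F + U G`, where `F` and `G` come from `C(𝕋, 𝒪₂)` with the circle coordinate sent to `U²`;
these sums are dense (`dense_circleHom_add`).

Let `h t = exp (πi(t - 1)/2)`. Send `a` to the constant function `fixedHom a` and `U` to `h u`. This
pair is covariant, and `h²` wraps `[-1, 1]` once around the circle, so `F + U G` becomes `t ↦
fixedHom (F (h²)) + h u fixedHom (G (h²))`. Since `h 1 = 1` and `h (-1) = -1`, the `u`-part changes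
sign between the endpoints, which is what `σ` does to it.

Injectivity: the two components of a split element are bounded by its norm (`norm_fixedHom_le`), so
`‖x‖ ≤ 2 ‖toFunctions x‖` on a dense set, hence everywhere. Surjectivity: the even and odd parts of
`f` under `σ`, the odd one untwisted by `h` and `u`, agree at the two endpoints and so descend to
the circle. -/

theorem ContinuousMap.exists_partition_approx {X V : Type*} [TopologicalSpace X] [CompactSpace X]
    [T2Space X] [SeminormedAddCommGroup V] [NormedSpace ℝ V] (f : C(X, V)) {ε : ℝ} (hε : 0 < ε) :
    ∃ (n : ℕ) (h : Fin n → C(X, ℝ)) (x : Fin n → X), (∀ j t, 0 ≤ h j t) ∧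
      (∀ t, ∑ j, h j t = 1) ∧ ∀ t, ‖f t - ∑ j, h j t • f (x j)‖ ≤ ε := by
  have hU : ∀ x : X, IsOpen (f ⁻¹' Metric.ball (f x) ε) := fun x =>
    Metric.isOpen_ball.preimage f.continuous
  obtain ⟨s, hs⟩ := isCompact_univ.elim_finite_subcover _ hU fun x _ =>
    Set.mem_iUnion.2 ⟨x, Metric.mem_ball_self hε⟩
  let x : Fin s.card → X := fun j => (s.equivFin.symm j : X)
  have hcov : (Set.univ : Set X) ⊆ ⋃ j, f ⁻¹' Metric.ball (f (x j)) ε := by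
    intro t ht
    obtain ⟨y, hy, hty⟩ := Set.mem_iUnion₂.1 (hs ht)
    refine Set.mem_iUnion.2 ⟨s.equivFin ⟨y, hy⟩, ?_⟩
    simpa [x] using hty
  obtain ⟨h, hsupp, hsum, hnn, -⟩ :=
    exists_continuous_sum_one_of_isOpen_isCompact (fun j => hU (x j)) isCompact_univ hcov
  have hsum' : ∀ t, ∑ j, h j t = 1 := fun t => by simpa using hsum (Set.mem_univ t)
  refine ⟨_, h, x, fun j t => (hnn j t).1, hsum', fun t => ?_⟩
  -- The weights sum to one, so the error is an average of the differences `f t - f (x j)`, and only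
  -- those `j` with `f t` within `ε` of `f (x j)` have nonzero weight.
  have h1 : f t - ∑ j, h j t • f (x j) = ∑ j, h j t • (f t - f (x j)) := by
    simp only [smul_sub, Finset.sum_sub_distrib, ← Finset.sum_smul, hsum', one_smul]
  rw [h1]
  calc ‖∑ j, h j t • (f t - f (x j))‖ ≤ ∑ j, h j t * ε := by
        refine norm_sum_le_of_le _ fun j _ => ?_
        rw [norm_smul, Real.norm_of_nonneg (hnn j t).1]
        rcases eq_or_ne (h j t) 0 with h0 | h0
        · simp [h0]
        · refine mul_le_mul_of_nonneg_left ?_ (hnn j t).1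
          have := hsupp j (subset_tsupport _ h0)
          exact (mem_ball_iff_norm.1 this).le
    _ = ε := by rw [← Finset.sum_mul, hsum', one_mul]

/-- An operator form of "variance is nonnegative": with `m` the weighted mean, `0 ≤ ∑ (b j - m)* h j
(b j - m) = ∑ (b j)* h j (b j) - m* m`. Commutation bounds each term of the last sum by `M² h j`, so
`m* m ≤ M²`. -/
theorem norm_sum_mul_le_of_commute {B : Type*} [CStarAlgebra B] [PartialOrder B] [StarOrderedRing B]
    {n : ℕ} {h b : Fin n → B} {M : ℝ} (hM : 0 ≤ M) (hh : ∀ j, 0 ≤ h j) (hsum : ∑ j, h j = 1)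
    (hcomm : ∀ j (c : B), c = b j ∨ c = star (b j) → Commute (h j) c) (hb : ∀ j, ‖b j‖ ≤ M) :
    ‖∑ j, h j * b j‖ ≤ M := by
  set m := ∑ j, h j * b j with hm
  have hsm : ∑ j, star (b j) * h j = star m := by
    simp [hm, star_sum, fun j => (IsSelfAdjoint.of_nonneg (hh j)).star_eq]
  have h1 : 0 ≤ ∑ j, star (b j - m) * h j * (b j - m) :=
    Finset.sum_nonneg fun j _ => star_left_conjugate_nonneg (hh j) _
  have h2 : ∑ j, star (b j - m) * h j * (b j - m) = ∑ j, star (b j) * h j * b j - star m * m := by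
    have h3 : ∀ j, star (b j - m) * h j * (b j - m) = star (b j) * h j * b j
        - star (b j) * h j * m - star m * (h j * b j) + star m * h j * m := fun j => by
      rw [star_sub]; noncomm_ring
    simp only [h3, Finset.sum_add_distrib, Finset.sum_sub_distrib, ← Finset.sum_mul,
      ← Finset.mul_sum, hsum, hsm, ← hm]
    noncomm_ring
  have h3 : ∀ j, star (b j) * h j * b j ≤ algebraMap ℝ B (M ^ 2) * h j := fun j => by
    have hbb : star (b j) * b j ≤ algebraMap ℝ B (M ^ 2) := by
      refine (CStarAlgebra.star_mul_le_algebraMap_norm_sq).trans ?_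
      exact algebraMap_mono _ (pow_le_pow_left₀ (norm_nonneg _) (hb j) 2)
    have hc : Commute (algebraMap ℝ B (M ^ 2) - star (b j) * b j) (h j) :=
      ((Algebra.commute_algebraMap_left _ _).sub_left
        ((hcomm j _ (Or.inr rfl)).symm.mul_left (hcomm j _ (Or.inl rfl)).symm))
    have := Commute.mul_nonneg (sub_nonneg.2 hbb) (hh j) hc
    rw [sub_mul, sub_nonneg, mul_assoc, ← (hcomm j _ (Or.inl rfl)).eq, ← mul_assoc] at this
    exact this
  have h4 : star m * m ≤ algebraMap ℝ B (M ^ 2) := by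
    rw [h2, sub_nonneg] at h1
    refine h1.trans ((Finset.sum_le_sum fun j _ => h3 j).trans_eq ?_)
    rw [← Finset.mul_sum, hsum, mul_one]
  have h5 : ‖m‖ ^ 2 ≤ M ^ 2 := by
    rw [sq, ← CStarRing.norm_star_mul_self]
    exact (CStarAlgebra.norm_le_iff_le_algebraMap _ (by positivity) (star_mul_self_nonneg m)).2 h4
  exact le_of_sq_le_sq h5 hM

/-! ### The universal property of the algebra of continuous functions into a C*-algebra -/

theorem continuous_starAlgHom {A B : Type*} [CStarAlgebra A] [CStarAlgebra B] (φ : A →⋆ₐ[ℂ] B) :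
    Continuous φ :=
  AddMonoidHomClass.continuous_of_bound φ 1 fun a => by
    rw [one_mul]; exact NonUnitalStarAlgHom.norm_apply_le φ a

namespace ContinuousMap

open scoped TensorProduct

section

variable (X : Type*) [TopologicalSpace X] (A : Type*) [CStarAlgebra A]

/-- The constant functions in `C(X, A)`. -/
def constHom : A →⋆ₐ[ℂ] C(X, A) where
  toFun a := const X a
  map_one' := rfl
  map_mul' _ _ := rfl
  map_zero' := rfl
  map_add' _ _ := rfl
  commutes' _ := rfl
  map_star' _ := rfl

/-- The scalar functions in `C(X, A)`. -/
def scalarHom : C(X, ℂ) →⋆ₐ[ℂ] C(X, A) where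
  toFun g := ⟨fun x => algebraMap ℂ A (g x), by fun_prop⟩
  map_one' := by ext; simp
  map_mul' _ _ := by ext; simp
  map_zero' := by ext; simp
  map_add' _ _ := by ext; simp
  commutes' c := by
    ext x
    change algebraMap ℂ A (algebraMap ℂ ℂ c) = algebraMap ℂ A c
    rfl
  map_star' g := ContinuousMap.ext fun x => algebraMap_star_comm (g x)

variable {X A}

@[simp] theorem constHom_apply (a : A) (x : X) : constHom X A a x = a := rfl

@[simp] theorem scalarHom_apply (g : C(X, ℂ)) (x : X) :
    scalarHom X A g x = algebraMap ℂ A (g x) := rfl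

theorem commute_scalarHom (g : C(X, ℂ)) (f : C(X, A)) : Commute (scalarHom X A g) f :=
  ContinuousMap.ext fun _ => Algebra.commutes _ _

end

section

variable {X : Type*} [TopologicalSpace X]
  {A B : Type*} [CStarAlgebra A] [CStarAlgebra B]

/-- The homomorphism from the algebraic tensor product given by commuting homomorphisms. -/
def tensorLift (φ : C(X, ℂ) →⋆ₐ[ℂ] B) (ι : A →⋆ₐ[ℂ] B) (hc : ∀ g a, Commute (φ g) (ι a)) :
    C(X, ℂ) ⊗[ℂ] A →ₐ[ℂ] B :=
  Algebra.TensorProduct.lift (φ : C(X, ℂ) →ₐ[ℂ] B) (ι : A →ₐ[ℂ] B) hc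

theorem tensorLift_tmul (φ : C(X, ℂ) →⋆ₐ[ℂ] B) (ι : A →⋆ₐ[ℂ] B)
    (hc : ∀ g a, Commute (φ g) (ι a)) (g : C(X, ℂ)) (a : A) :
    tensorLift φ ι hc (g ⊗ₜ a) = φ g * ι a := rfl

variable (X A) in
/-- The algebraic tensor product `C(X) ⊗ A` as functions from `X` to `A`. -/
def tensorEval : C(X, ℂ) ⊗[ℂ] A →ₐ[ℂ] C(X, A) :=
  Algebra.TensorProduct.lift (scalarHom X A : C(X, ℂ) →ₐ[ℂ] C(X, A))
    (constHom X A : A →ₐ[ℂ] C(X, A)) fun g a => commute_scalarHom g (constHom X A a)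

theorem tensorEval_tmul (g : C(X, ℂ)) (a : A) :
    tensorEval X A (g ⊗ₜ a) = scalarHom X A g * constHom X A a := rfl

/-- A stand-in for an involution on the tensor product: a single `w'` serves the evaluation and
every lift, which is what extending `star` compatibility by density requires. -/
theorem exists_star_tensor (w : C(X, ℂ) ⊗[ℂ] A) : ∃ w' : C(X, ℂ) ⊗[ℂ] A,
    tensorEval X A w' = star (tensorEval X A w) ∧
      ∀ (φ : C(X, ℂ) →⋆ₐ[ℂ] B) (ι : A →⋆ₐ[ℂ] B) (hc : ∀ g a, Commute (φ g) (ι a)),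
        tensorLift φ ι hc w' = star (tensorLift φ ι hc w) := by
  induction w using TensorProduct.induction_on with
  | zero => exact ⟨0, by simp, by simp⟩
  | tmul g a =>
    refine ⟨star g ⊗ₜ star a, ?_, fun φ ι hc => ?_⟩
    · ext x
      simp only [tensorEval_tmul, star_apply, mul_apply, scalarHom_apply, constHom_apply, star_mul]
      rw [← algebraMap_star_comm]
      exact Algebra.commutes _ _
    · rw [tensorLift_tmul, tensorLift_tmul, star_mul, ← map_star, ← map_star]
      exact (hc _ _).eq
  | add x y hx hy =>
    obtain ⟨x', hx, hx'⟩ := hx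
    obtain ⟨y', hy, hy'⟩ := hy
    exact ⟨x' + y', by rw [map_add, hx, hy, map_add, star_add],
      fun φ ι hc => by rw [map_add, hx', hy', map_add, star_add]⟩

variable [CompactSpace X] [T2Space X]

theorem denseRange_tensorEval : DenseRange (tensorEval X A) := by
  intro f
  rw [Metric.mem_closure_iff]
  intro ε hε
  obtain ⟨n, h, x, -, -, happ⟩ := exists_partition_approx f (half_pos hε)
  refine ⟨_, ⟨∑ j, (⟨fun t => (h j t : ℂ), by fun_prop⟩ : C(X, ℂ)) ⊗ₜ f (x j), rfl⟩, ?_⟩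
  refine lt_of_le_of_lt ?_ (half_lt_self hε)
  rw [dist_eq_norm, ContinuousMap.norm_le _ (half_pos hε).le]
  intro t
  convert happ t using 2
  rw [map_sum, sub_apply, sum_apply]
  congr 1
  refine Finset.sum_congr rfl fun j _ => ?_
  rw [tensorEval_tmul, mul_apply, scalarHom_apply, constHom_apply, ← Algebra.smul_def]
  exact Complex.coe_smul _ _

/-- Contractivity is what lets the lift pass to the completion `C(X, A)`. Up to `δ`, a partition of
unity replaces the image of `w` by `∑ φ (h j) * ι (w (x j))`, a commuting convex combination of
elements of norm at most the supremum norm of `w`. -/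
theorem norm_tensorLift_le (φ : C(X, ℂ) →⋆ₐ[ℂ] B) (ι : A →⋆ₐ[ℂ] B)
    (hc : ∀ g a, Commute (φ g) (ι a)) (w : C(X, ℂ) ⊗[ℂ] A) :
    ‖tensorLift φ ι hc w‖ ≤ 1 * ‖tensorEval X A w‖ := by
  let _ : PartialOrder B := CStarAlgebra.spectralOrder B
  have : StarOrderedRing B := CStarAlgebra.spectralOrderedRing B
  rw [one_mul]
  obtain ⟨S, rfl⟩ := TensorProduct.exists_finset w
  set w := ∑ i ∈ S, i.1 ⊗ₜ[ℂ] i.2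
  refine le_of_forall_pos_le_add fun δ hδ => ?_
  -- The added `1` keeps the divisor positive even when all the coefficients vanish.
  set K : ℝ := ∑ i ∈ S, ‖i.2‖ + 1
  have hK : 0 < K := by positivity
  -- Bundling the scalar factors into one vector-valued function makes one partition of unity work
  -- for all of them.
  let F : C(X, S → ℂ) := ⟨fun t i => i.1.1 t, by fun_prop⟩
  obtain ⟨n, h, x, hnn, hsum, happ⟩ := exists_partition_approx F (div_pos hδ hK)
  let hC : Fin n → C(X, ℂ) := fun j => ⟨fun t => (h j t : ℂ), by fun_prop⟩
  -- Square roots exhibit `φ (hC j)` as `star (φ (r j)) * φ (r j)`, hence as positive.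
  let r : Fin n → C(X, ℂ) := fun j => ⟨fun t => (Real.sqrt (h j t) : ℂ), by fun_prop⟩
  have hr : ∀ j, hC j = star (r j) * r j := fun j => by
    ext t
    simp only [hC, r, coe_mk, mul_apply, star_apply, RCLike.star_def, Complex.conj_ofReal]
    rw [← Complex.ofReal_mul, Real.mul_self_sqrt (hnn j t)]
  have happ' : ∀ i ∈ S, ‖i.1 - ∑ j, i.1 (x j) • hC j‖ ≤ δ / K := fun i hi => by
    rw [ContinuousMap.norm_le _ (div_pos hδ hK).le]
    intro t
    refine le_trans (le_of_eq ?_) ((norm_le_pi_norm (F t - ∑ j, h j t • F (x j)) ⟨i, hi⟩).trans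
      (happ t))
    rw [sub_apply, sum_apply, Pi.sub_apply, Finset.sum_apply]
    congr 2
    refine Finset.sum_congr rfl fun j _ => ?_
    simp [hC, F, mul_comm]
  have hval : ∀ j, ι (tensorEval X A w (x j)) = ∑ i ∈ S, i.1 (x j) • ι i.2 := fun j => by
    simp only [w, map_sum, sum_apply]
    refine Finset.sum_congr rfl fun i _ => ?_
    rw [tensorEval_tmul, mul_apply, scalarHom_apply, constHom_apply, ← Algebra.smul_def, map_smul]
  have hmain : ‖∑ j, φ (hC j) * ι (tensorEval X A w (x j))‖ ≤ ‖tensorEval X A w‖ := by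
    refine norm_sum_mul_le_of_commute (norm_nonneg _) (fun j => ?_) ?_ ?_ fun j => ?_
    · rw [hr, map_mul, map_star]
      exact star_mul_self_nonneg _
    · rw [← map_sum, ← map_one φ]
      congr 1
      ext t
      simpa [hC] using congrArg (fun s : ℝ => (s : ℂ)) (hsum t)
    · rintro j c (rfl | rfl)
      · exact hc _ _
      · rw [← map_star]; exact hc _ _
    · exact (NonUnitalStarAlgHom.norm_apply_le ι _).trans (norm_coe_le_norm _ _)
  have hdiff : tensorLift φ ι hc w - ∑ j, φ (hC j) * ι (tensorEval X A w (x j)) =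
      ∑ i ∈ S, φ (i.1 - ∑ j, i.1 (x j) • hC j) * ι i.2 := by
    simp only [hval, Finset.mul_sum, map_sub, sub_mul, Finset.sum_sub_distrib, map_sum,
      Finset.sum_mul, map_smul, smul_mul_assoc, mul_smul_comm]
    rw [Finset.sum_comm, map_sum]
    rfl
  have hsmall : ‖∑ i ∈ S, φ (i.1 - ∑ j, i.1 (x j) • hC j) * ι i.2‖ ≤ δ := by
    calc _ ≤ ∑ i ∈ S, δ / K * ‖i.2‖ := by
          refine norm_sum_le_of_le _ fun i hi => (norm_mul_le _ _).trans ?_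
          gcongr
          · exact (NonUnitalStarAlgHom.norm_apply_le φ _).trans (happ' i hi)
          · exact NonUnitalStarAlgHom.norm_apply_le ι _
      _ ≤ δ / K * K := by
          rw [← Finset.mul_sum]
          exact mul_le_mul_of_nonneg_left (by simp [K]) (div_pos hδ hK).le
      _ = δ := div_mul_cancel₀ _ hK.ne'
  rw [← hdiff] at hsmall
  linarith [norm_le_norm_add_norm_sub (∑ j, φ (hC j) * ι (tensorEval X A w (x j)))
    (tensorLift φ ι hc w), norm_sub_rev (tensorLift φ ι hc w)
      (∑ j, φ (hC j) * ι (tensorEval X A w (x j)))]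

section

variable (φ : C(X, ℂ) →⋆ₐ[ℂ] B) (ι : A →⋆ₐ[ℂ] B) (hc : ∀ g a, Commute (φ g) (ι a))

/-- The linear map underlying `ContinuousMap.liftHom`. -/
def liftLinear : C(X, A) →L[ℂ] B :=
  (tensorLift φ ι hc).toLinearMap.extendOfNorm (tensorEval X A).toLinearMap

theorem liftLinear_tensorEval (w : C(X, ℂ) ⊗[ℂ] A) :
    liftLinear φ ι hc (tensorEval X A w) = tensorLift φ ι hc w :=
  LinearMap.extendOfNorm_eq (f := (tensorLift φ ι hc).toLinearMap)
    (e := (tensorEval X A).toLinearMap) denseRange_tensorEval ⟨1, norm_tensorLift_le φ ι hc⟩ w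

theorem liftLinear_const (a : A) : liftLinear φ ι hc (constHom X A a) = ι a := by
  have h := liftLinear_tensorEval φ ι hc (1 ⊗ₜ a)
  rwa [tensorEval_tmul, tensorLift_tmul, map_one, map_one, one_mul, one_mul] at h

/-- The universal property of `C(X, A)`: commuting homomorphisms from `C(X)` and from `A` induce a
homomorphism from `C(X, A)`. -/
def liftHom : C(X, A) →⋆ₐ[ℂ] B where
  toFun := liftLinear φ ι hc
  map_one' := by
    rw [← map_one (constHom X A), liftLinear_const, map_one]
  map_mul' a b := by
    refine denseRange_tensorEval.induction_on₂
      (p := fun a b => liftLinear φ ι hc (a * b) = liftLinear φ ι hc a * liftLinear φ ι hc b)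
      (isClosed_eq (by fun_prop) (by fun_prop)) (fun p q => ?_) a b
    rw [← map_mul, liftLinear_tensorEval, liftLinear_tensorEval, liftLinear_tensorEval, map_mul]
  map_zero' := map_zero _
  map_add' := map_add _
  commutes' c := by
    have h : (algebraMap ℂ C(X, A) c) = constHom X A (algebraMap ℂ A c) := rfl
    rw [h, liftLinear_const, AlgHomClass.commutes]
  map_star' a := by
    refine denseRange_tensorEval.induction_on
      (p := fun a => liftLinear φ ι hc (star a) = star (liftLinear φ ι hc a)) a
      (isClosed_eq (by fun_prop) (by fun_prop)) (fun p => ?_)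
    obtain ⟨q, hq, hq'⟩ := exists_star_tensor (B := B) p
    rw [← hq, liftLinear_tensorEval, liftLinear_tensorEval, hq']

theorem liftHom_constHom (a : A) : liftHom φ ι hc (constHom X A a) = ι a := 
  liftLinear_const φ ι hc a

theorem liftHom_scalarHom (g : C(X, ℂ)) : liftHom φ ι hc (scalarHom X A g) = φ g := by
  have h := liftLinear_tensorEval φ ι hc (g ⊗ₜ 1)
  rwa [tensorEval_tmul, tensorLift_tmul, map_one, map_one, mul_one, mul_one] at h

end

theorem starAlgHom_ext_tensor {φ ψ : C(X, A) →⋆ₐ[ℂ] B}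
    (hs : ∀ g, φ (scalarHom X A g) = ψ (scalarHom X A g))
    (hconst : ∀ a, φ (constHom X A a) = ψ (constHom X A a)) : φ = ψ := by
  have hφ : Continuous φ := continuous_starAlgHom φ
  have hψ : Continuous ψ := continuous_starAlgHom ψ
  refine DFunLike.ext' (denseRange_tensorEval.equalizer hφ hψ (funext fun w => ?_))
  induction w using TensorProduct.induction_on with
  | zero => simp
  | tmul g a => simp only [Function.comp_apply, tensorEval_tmul, map_mul, hs, hconst]
  | add x y hx hy =>
    simp only [Function.comp_apply, map_add] at hx hy ⊢
    rw [hx, hy]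

end

end ContinuousMap

/-! ### Functional calculus of a unitary on the unit circle -/

/-- The functional calculus of a unitary, on the whole unit circle. -/
def unitaryCalculus {B : Type*} [CStarAlgebra B] {z : B} (hz : z ∈ unitary B) :
    C(Metric.sphere (0 : ℂ) 1, ℂ) →⋆ₐ[ℂ] B :=
  (cfcHom (R := ℂ) (a := z) (isStarNormal_of_mem_unitary hz)).comp
    (ContinuousMap.compStarAlgHom' ℂ ℂ
      ⟨Set.inclusion (spectrum.subset_circle_of_unitary hz), continuous_inclusion _⟩)

/-- The inclusion of the unit circle in the complex plane. -/
def circleCoord : C(Metric.sphere (0 : ℂ) 1, ℂ) := ⟨Subtype.val, continuous_subtype_val⟩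

theorem unitaryCalculus_circleCoord {B : Type*} [CStarAlgebra B] {z : B} (hz : z ∈ unitary B) :
    unitaryCalculus hz circleCoord = z :=
  cfcHom_id (R := ℂ) (a := z) _

theorem commute_unitaryCalculus {B : Type*} [CStarAlgebra B] {z : B} (hz : z ∈ unitary B) {b : B}
    (h : Commute z b) (h' : Commute (star z) b) (g : C(Metric.sphere (0 : ℂ) 1, ℂ)) :
    Commute (unitaryCalculus hz g) b :=
  Commute.cfcHom _ h h' _

theorem starAlgHom_ext_circleCoord {B : Type*} [CStarAlgebra B]
    {φ ψ : C(Metric.sphere (0 : ℂ) 1, ℂ) →⋆ₐ[ℂ] B} (h : φ circleCoord = ψ circleCoord) : φ = ψ := by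
  have hφ : Continuous φ := continuous_starAlgHom φ
  have hψ : Continuous ψ := continuous_starAlgHom ψ
  refine StarAlgHom.ext fun f => ?_
  induction f using ContinuousMap.induction_on_of_compact with
  | const r => exact (AlgHomClass.commutes φ r).trans (AlgHomClass.commutes ψ r).symm
  | id => exact h
  | star_id => rw [map_star, map_star]; exact congrArg star h
  | add f g hf hg => rw [map_add, map_add, hf, hg]
  | mul f g hf hg => rw [map_mul, map_mul, hf, hg]
  | frequently f hf => exact hf.mem_of_closed (isClosed_eq hφ hψ)

/-! ### Subalgebras generated by a subalgebra and a normalizing element -/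

/-- The star subalgebra of the elements `m + v n` with `m`, `n` in a star subalgebra `S` that `v`
normalizes. -/
def StarSubalgebra.adjoinNormalizer {B : Type*} [Ring B] [StarRing B] [Algebra ℂ B]
    [StarModule ℂ B] (S : StarSubalgebra ℂ B) (v : B) (hsq : v * v ∈ S)
    (hstar : ∃ s ∈ S, star v = v * s) (hnorm : ∀ m ∈ S, ∃ m' ∈ S, m * v = v * m') :
    StarSubalgebra ℂ B where
  carrier := {x | ∃ m ∈ S, ∃ n ∈ S, x = m + v * n}
  mul_mem' := by
    rintro _ _ ⟨m, hm, n, hn, rfl⟩ ⟨m', hm', n', hn', rfl⟩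
    obtain ⟨k, hk, hk'⟩ := hnorm m hm
    obtain ⟨l, hl, hl'⟩ := hnorm n hn
    refine ⟨m * m' + v * v * (l * n'), add_mem (mul_mem hm hm') (mul_mem hsq (mul_mem hl hn')),
      k * n' + n * m', add_mem (mul_mem hk hn') (mul_mem hn hm'), ?_⟩
    calc (m + v * n) * (m' + v * n') = m * m' + m * v * n' + v * n * m' + v * (n * v) * n' := by
          noncomm_ring
      _ = _ := by rw [hk', hl']; noncomm_ring
  add_mem' := by
    rintro _ _ ⟨m, hm, n, hn, rfl⟩ ⟨m', hm', n', hn', rfl⟩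
    exact ⟨m + m', add_mem hm hm', n + n', add_mem hn hn', by rw [mul_add]; abel⟩
  algebraMap_mem' c := ⟨algebraMap ℂ B c, algebraMap_mem S c, 0, zero_mem S, by simp⟩
  star_mem' := by
    rintro _ ⟨m, hm, n, hn, rfl⟩
    obtain ⟨s, hs, hs'⟩ := hstar
    obtain ⟨k, hk, hk'⟩ := hnorm (star n) (star_mem hn)
    exact ⟨star m, star_mem hm, k * s, mul_mem hk hs, by
      rw [star_add, star_mul, hs', ← mul_assoc, hk', mul_assoc]⟩

namespace CStarRelations

theorem dense_of_gen_mem {X : Type u} (R : CStarRelations X) (P : StarSubalgebra ℂ R.Universal)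
    (h : ∀ x, R.gen x ∈ P) : Dense (P : Set R.Universal) := by
  refine R.denseRange_evalAt_gen.mono ?_
  rintro _ ⟨p, rfl⟩
  induction p using FreeAlgebra.induction with
  | grade0 c => rw [AlgHom.commutes]; exact algebraMap_mem P c
  | grade1 x =>
    rcases x with x | x
    · simpa [evalAt] using h x
    · simpa [evalAt] using star_mem (h x)
  | mul a b ha hb => rw [map_mul]; exact mul_mem ha hb
  | add a b ha hb => rw [map_add]; exact add_mem ha hb

end CStarRelations

/-! ### Cuntz pairs and covariant self-adjoint unitaries -/

/-- The scalar `1 / √2`. -/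
def invSqrtTwo : ℂ := ((Real.sqrt 2 / 2 : ℝ) : ℂ)

theorem invSqrtTwo_mul_self : invSqrtTwo * invSqrtTwo = 1 / 2 := by
  have h : Real.sqrt 2 / 2 * (Real.sqrt 2 / 2) = 1 / 2 := by
    rw [div_mul_div_comm, Real.mul_self_sqrt (by norm_num)]; norm_num
  rw [invSqrtTwo, ← Complex.ofReal_mul, h]
  norm_num

theorem star_invSqrtTwo : star invSqrtTwo = invSqrtTwo := Complex.conj_ofReal _

theorem invSqrtTwo_smul_smul {B : Type*} [AddCommGroup B] [Module ℂ B] (x : B) :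
    invSqrtTwo • invSqrtTwo • (x + x) = x := by
  rw [smul_smul, invSqrtTwo_mul_self, ← two_smul ℂ x, smul_smul]
  norm_num

theorem star_invSqrtTwo_smul_mul {B : Type*} [CStarAlgebra B] {x y z : B}
    (h : star x * y = z + z) : star (invSqrtTwo • x) * (invSqrtTwo • y) = z := by
  rw [star_smul, star_invSqrtTwo, smul_mul_assoc, mul_smul_comm, h, invSqrtTwo_smul_smul]

theorem invSqrtTwo_smul_mul_star {B : Type*} [CStarAlgebra B] (x y : B) :
    (invSqrtTwo • x) * star (invSqrtTwo • y) = invSqrtTwo • invSqrtTwo • (x * star y) := by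
  rw [star_smul, star_invSqrtTwo, smul_mul_assoc, mul_smul_comm]

namespace IsCuntzPair

section

variable {B : Type u} [CStarAlgebra B] {S T : B}

/-- Multiplying the sum relation on the left by `star S` leaves `star S * T * star T = 0`; then
cancel the isometry `T`. -/
theorem star_mul_eq_zero (h : IsCuntzPair S T) : star S * T = 0 := by
  have h1 : star S * (S * star S + T * star T) = star S + star S * T * star T := by
    rw [mul_add, ← mul_assoc, h.isometry₁, one_mul, mul_assoc]
  rw [h.sum_eq_one, mul_one, left_eq_add] at h1
  rw [← mul_one (star S * T), ← h.isometry₂, ← mul_assoc, h1, zero_mul]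

theorem star_mul_eq_zero' (h : IsCuntzPair S T) : star T * S = 0 := by
  rw [← star_star S, ← star_mul, h.star_mul_eq_zero, star_zero]

theorem map {C : Type u} [CStarAlgebra C] (h : IsCuntzPair S T) (φ : B →⋆ₐ[ℂ] C) :
    IsCuntzPair (φ S) (φ T) where
  isometry₁ := by rw [← map_star, ← map_mul, h.isometry₁, map_one]
  isometry₂ := by rw [← map_star, ← map_mul, h.isometry₂, map_one]
  sum_eq_one := by
    rw [← map_star, ← map_mul, ← map_star, ← map_mul, ← map_add, h.sum_eq_one, map_one]

/-- The difference of the range projections of a Cuntz pair. -/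
def symmetry (S T : B) : B := S * star S - T * star T

theorem star_symmetry (S T : B) : star (symmetry S T) = symmetry S T := by
  simp [symmetry]

theorem symmetry_mul_left (h : IsCuntzPair S T) : symmetry S T * S = S := by
  rw [symmetry, sub_mul, mul_assoc, mul_assoc, h.isometry₁, h.star_mul_eq_zero', mul_one, mul_zero,
    sub_zero]

theorem symmetry_mul_right (h : IsCuntzPair S T) : symmetry S T * T = -T := by
  rw [symmetry, sub_mul, mul_assoc, mul_assoc, h.isometry₂, h.star_mul_eq_zero, mul_one, mul_zero,
    zero_sub]

theorem symmetry_mul_self (h : IsCuntzPair S T) : symmetry S T * symmetry S T = 1 := by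
  have h1 : symmetry S T * (S * star S - T * star T) = 1 := by
    rw [mul_sub, ← mul_assoc, ← mul_assoc, h.symmetry_mul_left, h.symmetry_mul_right, neg_mul,
      sub_neg_eq_add, h.sum_eq_one]
  exact h1

theorem symmetry_mul_invSqrtTwo_smul_add (h : IsCuntzPair S T) :
    symmetry S T * (invSqrtTwo • (S + T)) = invSqrtTwo • (S - T) := by
  rw [mul_smul_comm, mul_add, h.symmetry_mul_left, h.symmetry_mul_right, sub_eq_add_neg]

/-- With `w` the symmetry and `R` the first isometry, `w R` is `(S - T)/√2`, so the cross terms in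
the sum of the range projections cancel. For the canonical pair both new isometries are fixed by
`σ`, because `R` is fixed and `w` changes sign twice. -/
theorem rotate (h : IsCuntzPair S T) : IsCuntzPair (invSqrtTwo • (S + T))
    (symmetry S T * (invSqrtTwo • (S + T)) * symmetry S T) := by
  have h1 : star (invSqrtTwo • (S + T)) * (invSqrtTwo • (S + T)) = 1 := by
    refine star_invSqrtTwo_smul_mul ?_
    rw [star_add, add_mul, mul_add, mul_add, h.isometry₁, h.isometry₂, h.star_mul_eq_zero,
      h.star_mul_eq_zero', add_zero, zero_add]
  refine ⟨h1, ?_, ?_⟩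
  · generalize invSqrtTwo • (S + T) = R at h1
    rw [star_mul, star_mul, star_symmetry]
    calc symmetry S T * (star R * symmetry S T) * (symmetry S T * R * symmetry S T)
        = symmetry S T * star R * (symmetry S T * symmetry S T) * R * symmetry S T := by
          noncomm_ring
      _ = symmetry S T * (star R * R) * symmetry S T := by
          rw [h.symmetry_mul_self]; noncomm_ring
      _ = 1 := by rw [h1, mul_one, h.symmetry_mul_self]
  · rw [h.symmetry_mul_invSqrtTwo_smul_add, star_mul, star_symmetry]
    calc _ = (invSqrtTwo • (S + T)) * star (invSqrtTwo • (S + T)) +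
          (invSqrtTwo • (S - T)) * (symmetry S T * symmetry S T) * star (invSqrtTwo • (S - T)) := by
          simp only [mul_assoc]
      _ = invSqrtTwo • invSqrtTwo • ((S * star S + T * star T) + (S * star S + T * star T)) := by
          rw [h.symmetry_mul_self, mul_one, invSqrtTwo_smul_mul_star, invSqrtTwo_smul_mul_star,
            ← smul_add, ← smul_add, star_add, star_sub]
          congr 2
          noncomm_ring
      _ = 1 := by rw [invSqrtTwo_smul_smul, h.sum_eq_one]

end

section

variable {B : Type u} [CStarAlgebra B] {S T v : B}

/-- The inverse of `rotate`: when moreover `v * S = T * v`, the new pair has symmetry `v`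
(`symmetry_unrotate`), and rotating it gives back `S` and `v * S * v = T`. -/
theorem unrotate (h : IsCuntzPair S T) (hs : star v = v) (hv : v * v = 1) :
    IsCuntzPair (invSqrtTwo • (S + T * v)) (invSqrtTwo • (S - T * v)) := by
  have h1 : v * (star T * S) = 0 := by rw [h.star_mul_eq_zero', mul_zero]
  have h2 : star S * T * v = 0 := by rw [h.star_mul_eq_zero, zero_mul]
  have h3 : v * (star T * T) * v = 1 := by rw [h.isometry₂, mul_one, hv]
  refine ⟨star_invSqrtTwo_smul_mul ?_, star_invSqrtTwo_smul_mul ?_, ?_⟩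
  · rw [star_add, star_mul, hs]
    calc _ = star S * S + star S * T * v + v * (star T * S) + v * (star T * T) * v := by
          noncomm_ring
      _ = 1 + 1 := by rw [h1, h2, h3, h.isometry₁, add_zero, add_zero]
  · rw [star_sub, star_mul, hs]
    calc _ = star S * S - star S * T * v - v * (star T * S) + v * (star T * T) * v := by
          noncomm_ring
      _ = 1 + 1 := by rw [h1, h2, h3, h.isometry₁, sub_zero, sub_zero]
  · rw [invSqrtTwo_smul_mul_star, invSqrtTwo_smul_mul_star, ← smul_add, ← smul_add, star_add,
      star_sub, star_mul, hs]
    have h4 : (S + T * v) * (star S + v * star T) + (S - T * v) * (star S - v * star T) =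
        (S * star S + T * (v * v) * star T) + (S * star S + T * (v * v) * star T) := by
      noncomm_ring
    rw [h4, hv, mul_one, h.sum_eq_one, invSqrtTwo_smul_smul]

theorem symmetry_unrotate (h : IsCuntzPair S T) (hs : star v = v) (hv : v * v = 1)
    (hST : v * S = T * v) :
    symmetry (invSqrtTwo • (S + T * v)) (invSqrtTwo • (S - T * v)) = v := by
  have hT : v * star T = star S * v := by
    have := congrArg star hST
    rw [star_mul, star_mul, hs] at this
    exact this.symm
  have hS : v * star S = star T * v := by
    calc v * star S = v * (star S * v) * v := by
          rw [mul_assoc, mul_assoc, hv, mul_one]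
      _ = star T * v := by rw [← hT, ← mul_assoc, hv, one_mul]
  rw [symmetry, invSqrtTwo_smul_mul_star, invSqrtTwo_smul_mul_star, ← smul_sub, ← smul_sub,
    star_add, star_sub, star_mul, hs]
  have h4 : (S + T * v) * (star S + v * star T) - (S - T * v) * (star S - v * star T) =
      (S * (v * star T) + T * (v * star S)) + (S * (v * star T) + T * (v * star S)) := by
    noncomm_ring
  rw [h4, invSqrtTwo_smul_smul, hT, hS, ← mul_assoc, ← mul_assoc, ← add_mul, h.sum_eq_one, one_mul]

theorem rotate_unrotate :
    invSqrtTwo • (invSqrtTwo • (S + T * v) + invSqrtTwo • (S - T * v)) = S := by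
  rw [← smul_add, show S + T * v + (S - T * v) = S + S by abel, invSqrtTwo_smul_smul]

end

end IsCuntzPair

namespace CuntzAlgebraTwo

/-! ### The fixed point algebra of `σ` -/

/-- The self-adjoint unitary `S₁ S₁* - S₂ S₂*`. -/
def flipUnitary : CuntzAlgebraTwo := IsCuntzPair.symmetry S₁ S₂

theorem star_flipUnitary : star flipUnitary = flipUnitary := IsCuntzPair.star_symmetry _ _

theorem flipUnitary_mul_self : flipUnitary * flipUnitary = 1 := isCuntzPair.symmetry_mul_self

theorem flipUnitary_mem_unitary : flipUnitary ∈ unitary CuntzAlgebraTwo :=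
  ⟨by rw [star_flipUnitary, flipUnitary_mul_self], by rw [star_flipUnitary, flipUnitary_mul_self]⟩

theorem flipUnitary_mul_mul_self (a : CuntzAlgebraTwo) : flipUnitary * (flipUnitary * a) = a := by
  rw [← mul_assoc, flipUnitary_mul_self, one_mul]

theorem σ_flipUnitary : σ flipUnitary = -flipUnitary := by
  simp only [flipUnitary, IsCuntzPair.symmetry, map_sub, map_mul, map_star, σ_S₁, σ_S₂, neg_sub]

/-- Star homomorphisms on `𝒪₂` are determined by the canonical isometries. -/
theorem starAlgHom_ext {B : Type} [CStarAlgebra B] {φ ψ : CuntzAlgebraTwo →⋆ₐ[ℂ] B}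
    (h₁ : φ S₁ = ψ S₁) (h₂ : φ S₂ = ψ S₂) : φ = ψ :=
  cuntzRelations.hom_ext fun x => by
    fin_cases x
    · exact h₁
    · exact h₂

/-- The homomorphism from `𝒪₂` given by a Cuntz pair. -/
def ofPair {B : Type} [CStarAlgebra B] {S T : B} (h : IsCuntzPair S T) :
    CuntzAlgebraTwo →⋆ₐ[ℂ] B :=
  cuntzRelations.lift ![S, T] h

theorem ofPair_S₁ {B : Type} [CStarAlgebra B] {S T : B} (h : IsCuntzPair S T) :
    ofPair h S₁ = S := cuntzRelations.lift_gen _ _ 0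

theorem ofPair_S₂ {B : Type} [CStarAlgebra B] {S T : B} (h : IsCuntzPair S T) :
    ofPair h S₂ = T := cuntzRelations.lift_gen _ _ 1

/-- The isomorphism of `𝒪₂` onto the fixed point algebra of `σ`, as an endomorphism of `𝒪₂`. -/
def fixedHom : CuntzAlgebraTwo →⋆ₐ[ℂ] CuntzAlgebraTwo := ofPair isCuntzPair.rotate

theorem fixedHom_S₁ : fixedHom S₁ = invSqrtTwo • (S₁ + S₂) := ofPair_S₁ _

theorem fixedHom_S₂ : fixedHom S₂ = flipUnitary * fixedHom S₁ * flipUnitary := by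
  rw [fixedHom_S₁]; exact ofPair_S₂ _

theorem σ_fixedHom (a : CuntzAlgebraTwo) : σ (fixedHom a) = fixedHom a := by
  have h₁ : σ (fixedHom S₁) = fixedHom S₁ := by
    rw [fixedHom_S₁, map_smul, map_add, σ_S₁, σ_S₂, add_comm]
  have h : (σ : CuntzAlgebraTwo →⋆ₐ[ℂ] CuntzAlgebraTwo).comp fixedHom = fixedHom := by
    refine starAlgHom_ext h₁ ?_
    change σ (fixedHom S₂) = fixedHom S₂
    rw [fixedHom_S₂, map_mul, map_mul, h₁, σ_flipUnitary, neg_mul, neg_mul_neg]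
  exact DFunLike.congr_fun h a

/-- The second generator of the copy was chosen as the conjugate of the first by `u`; as `u² = 1`,
conjugation exchanges the two. -/
theorem flipUnitary_mul_fixedHom (a : CuntzAlgebraTwo) :
    flipUnitary * fixedHom a * flipUnitary = fixedHom (σ a) := by
  have h : (Unitary.conjStarAlgAut ℂ CuntzAlgebraTwo ⟨_, flipUnitary_mem_unitary⟩ :
      CuntzAlgebraTwo →⋆ₐ[ℂ] CuntzAlgebraTwo).comp fixedHom =
      fixedHom.comp (σ : CuntzAlgebraTwo →⋆ₐ[ℂ] CuntzAlgebraTwo) := by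
    refine starAlgHom_ext ?_ ?_
    · change flipUnitary * fixedHom S₁ * star flipUnitary = fixedHom (σ S₁)
      rw [star_flipUnitary, σ_S₁, fixedHom_S₂]
    · change flipUnitary * fixedHom S₂ * star flipUnitary = fixedHom (σ S₂)
      rw [star_flipUnitary, σ_S₂, fixedHom_S₂, mul_assoc, mul_assoc, mul_assoc,
        flipUnitary_mul_self, mul_one, flipUnitary_mul_mul_self]
  have h' := DFunLike.congr_fun h a
  change flipUnitary * fixedHom a * star flipUnitary = fixedHom (σ a) at h'
  rwa [star_flipUnitary] at h'

/-- The covariant representation `a ↦ S₁ a S₁* + S₂ σ(a) S₂*` of `𝒪₂` in itself. -/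
def diagHom : CuntzAlgebraTwo →⋆ₐ[ℂ] CuntzAlgebraTwo where
  toFun a := S₁ * a * star S₁ + S₂ * σ a * star S₂
  map_one' := by rw [map_one, mul_one, mul_one, isCuntzPair.sum_eq_one]
  map_mul' a b := by
    have h : (S₁ * a * star S₁ + S₂ * σ a * star S₂) * (S₁ * b * star S₁ + S₂ * σ b * star S₂) =
        S₁ * a * (star S₁ * S₁) * b * star S₁ + S₁ * a * (star S₁ * S₂) * σ b * star S₂ +
        S₂ * σ a * (star S₂ * S₁) * b * star S₁ + S₂ * σ a * (star S₂ * S₂) * σ b * star S₂ := by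
      noncomm_ring
    rw [h, isCuntzPair.isometry₁, isCuntzPair.isometry₂, isCuntzPair.star_mul_eq_zero,
      isCuntzPair.star_mul_eq_zero', map_mul]
    noncomm_ring
  map_zero' := by simp
  map_add' a b := by rw [map_add]; noncomm_ring
  commutes' c := by
    rw [AlgHomClass.commutes, ← Algebra.commutes, mul_assoc, ← Algebra.commutes c S₂, mul_assoc,
      ← mul_add, isCuntzPair.sum_eq_one, mul_one]
  map_star' a := by simp only [star_add, star_mul, star_star, map_star, mul_assoc]

theorem diagHom_apply (a : CuntzAlgebraTwo) :
    diagHom a = S₁ * a * star S₁ + S₂ * σ a * star S₂ := rfl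

/-- Compression by `S₁` recovers the first diagonal entry `a`. -/
theorem diagHom_injective : Function.Injective diagHom := by
  have h : ∀ a, star S₁ * diagHom a * S₁ = a := fun a => by
    have h1 : star S₁ * (S₁ * a * star S₁ + S₂ * σ a * star S₂) * S₁ =
        (star S₁ * S₁) * a * (star S₁ * S₁) + (star S₁ * S₂) * σ a * (star S₂ * S₁) := by
      noncomm_ring
    rw [diagHom_apply, h1, isCuntzPair.isometry₁, isCuntzPair.star_mul_eq_zero, one_mul, mul_one,
      zero_mul, zero_mul, add_zero]
  exact Function.LeftInverse.injective (g := fun x => star S₁ * x * S₁) h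

/-- The self-adjoint unitary `S₁ S₂* + S₂ S₁*`. -/
def exchange : CuntzAlgebraTwo := S₁ * star S₂ + S₂ * star S₁

theorem star_exchange : star exchange = exchange := by
  simp [exchange, add_comm]

theorem exchange_mul_S₁ : exchange * S₁ = S₂ := by
  rw [exchange, add_mul, mul_assoc, mul_assoc, isCuntzPair.isometry₁, isCuntzPair.star_mul_eq_zero',
    mul_zero, zero_add, mul_one]

theorem exchange_mul_S₂ : exchange * S₂ = S₁ := by
  rw [exchange, add_mul, mul_assoc, mul_assoc, isCuntzPair.isometry₂, isCuntzPair.star_mul_eq_zero,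
    mul_zero, add_zero, mul_one]

theorem exchange_mul_self : exchange * exchange = 1 := by
  have h : exchange * (S₁ * star S₂ + S₂ * star S₁) = 1 := by
    rw [mul_add, ← mul_assoc, ← mul_assoc, exchange_mul_S₁, exchange_mul_S₂, add_comm,
      isCuntzPair.sum_eq_one]
  exact h

theorem exchange_mul_diagHom (a : CuntzAlgebraTwo) :
    exchange * diagHom a = diagHom (σ a) * exchange := by
  have h₁ : star S₁ * exchange = star S₂ := by
    rw [← exchange_mul_S₁, star_mul, star_exchange]
  have h₂ : star S₂ * exchange = star S₁ := by
    rw [← exchange_mul_S₂, star_mul, star_exchange]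
  rw [diagHom_apply, diagHom_apply, mul_add, add_mul, mul_assoc _ (star S₁), mul_assoc _ (star S₂),
    h₁, h₂, ← mul_assoc, ← mul_assoc, ← mul_assoc, ← mul_assoc, exchange_mul_S₁, exchange_mul_S₂,
    σ_σ, add_comm]

/-- Simplicity of `𝒪₂` is avoided: `diagHom` with `exchange` is a covariant pair, so `unrotate`
yields an endomorphism `θ` with `θ ∘ fixedHom = diagHom`, and `diagHom` is injective. -/
theorem fixedHom_injective : Function.Injective fixedHom := by
  have hp : IsCuntzPair (diagHom S₁) (diagHom S₂) := isCuntzPair.map diagHom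
  have hST : exchange * diagHom S₁ = diagHom S₂ * exchange := by rw [exchange_mul_diagHom, σ_S₁]
  let θ : CuntzAlgebraTwo →⋆ₐ[ℂ] CuntzAlgebraTwo :=
    ofPair (hp.unrotate star_exchange exchange_mul_self)
  have hθ₁ : θ (fixedHom S₁) = diagHom S₁ := by
    rw [fixedHom_S₁, map_smul, map_add, ofPair_S₁, ofPair_S₂, IsCuntzPair.rotate_unrotate]
  have hθu : θ flipUnitary = exchange := by
    rw [← hp.symmetry_unrotate star_exchange exchange_mul_self hST]
    simp only [flipUnitary, IsCuntzPair.symmetry, map_sub, map_mul, map_star, θ, ofPair_S₁,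
      ofPair_S₂]
  have hθ : θ.comp fixedHom = diagHom := by
    refine starAlgHom_ext hθ₁ ?_
    change θ (fixedHom S₂) = diagHom S₂
    rw [fixedHom_S₂, map_mul, map_mul, hθ₁, hθu, hST, mul_assoc, exchange_mul_self, mul_one]
  refine Function.Injective.of_comp (f := θ) ?_
  have : θ ∘ fixedHom = diagHom := congrArg DFunLike.coe hθ
  rw [this]
  exact diagHom_injective

theorem norm_fixedHom (a : CuntzAlgebraTwo) : ‖fixedHom a‖ = ‖a‖ :=
  NonUnitalStarAlgHom.norm_map fixedHom fixedHom_injective a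

theorem norm_σ (a : CuntzAlgebraTwo) : ‖σ a‖ = ‖a‖ :=
  NonUnitalStarAlgHom.norm_map σ σ.injective a

theorem continuous_σ : Continuous σ := continuous_starAlgHom swapHom

/-- The elements `fixedHom a + u * fixedHom b` form a dense star subalgebra, and the average `(y + σ
y)/2` kills their `u`-part. As `fixedHom` has closed range, every average lies in it; a fixed point
is its own average. -/
theorem exists_fixedHom_eq (x : CuntzAlgebraTwo) (hx : σ x = x) : ∃ a, fixedHom a = x := by
  let P : StarSubalgebra ℂ CuntzAlgebraTwo := fixedHom.range.adjoinNormalizer flipUnitary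
    (by rw [flipUnitary_mul_self]; exact one_mem _)
    ⟨1, one_mem _, by rw [star_flipUnitary, mul_one]⟩
    (by
      rintro _ ⟨a, rfl⟩
      refine ⟨fixedHom (σ a), ⟨_, rfl⟩, ?_⟩
      change fixedHom a * flipUnitary = _
      rw [← flipUnitary_mul_fixedHom, mul_assoc, flipUnitary_mul_mul_self])
  have hu : flipUnitary * fixedHom S₁ = invSqrtTwo • (S₁ - S₂) := by
    rw [fixedHom_S₁]; exact isCuntzPair.symmetry_mul_invSqrtTwo_smul_add
  have hP : Dense (P : Set CuntzAlgebraTwo) := by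
    refine cuntzRelations.dense_of_gen_mem P fun i => ?_
    fin_cases i
    -- With `R = (S₁ + S₂)/√2` and `u R = (S₁ - S₂)/√2`, one has `S₁ = (R + u R)/√2` and `S₂ = (R -
    -- u R)/√2`.
    · refine ⟨_, ⟨invSqrtTwo • S₁, rfl⟩, _, ⟨invSqrtTwo • S₁, rfl⟩, ?_⟩
      change S₁ = fixedHom _ + _ * fixedHom _
      rw [map_smul, mul_smul_comm, hu, fixedHom_S₁, ← smul_add, ← smul_add,
        show S₁ + S₂ + (S₁ - S₂) = S₁ + S₁ by abel, invSqrtTwo_smul_smul]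
    · refine ⟨_, ⟨invSqrtTwo • S₁, rfl⟩, _, ⟨-(invSqrtTwo • S₁), rfl⟩, ?_⟩
      change S₂ = fixedHom _ + _ * fixedHom _
      rw [map_neg, map_smul, mul_neg, mul_smul_comm, hu, fixedHom_S₁, ← sub_eq_add_neg, ← smul_sub,
        ← smul_sub, show S₁ + S₂ - (S₁ - S₂) = S₂ + S₂ by abel, invSqrtTwo_smul_smul]
  have hclosed : IsClosed (Set.range fixedHom) :=
    (NonUnitalStarAlgHom.isometry fixedHom fixedHom_injective).isClosedEmbedding.isClosed_range
  have hmem : ∀ y : CuntzAlgebraTwo, (1 / 2 : ℂ) • (y + σ y) ∈ Set.range fixedHom := by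
    refine fun y => hP.induction (P := fun y => (1 / 2 : ℂ) • (y + σ y) ∈ Set.range fixedHom)
      ?_ ?_ y
    · rintro _ ⟨_, ⟨a, rfl⟩, _, ⟨b, rfl⟩, rfl⟩
      refine ⟨a, ?_⟩
      change fixedHom a = (1 / 2 : ℂ) • (fixedHom a + flipUnitary * fixedHom b +
        σ (fixedHom a + flipUnitary * fixedHom b))
      rw [map_add, map_mul, σ_fixedHom, σ_fixedHom, σ_flipUnitary, neg_mul,
        show fixedHom a + flipUnitary * fixedHom b + (fixedHom a + -(flipUnitary * fixedHom b)) =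
          fixedHom a + fixedHom a by abel, ← two_smul ℂ, smul_smul]
      norm_num
    · have := continuous_σ
      exact hclosed.preimage (f := fun y => (1 / 2 : ℂ) • (y + σ y)) (by fun_prop)
  obtain ⟨a, ha⟩ := hmem x
  refine ⟨a, ?_⟩
  rw [ha, hx, ← two_smul ℂ, smul_smul]
  norm_num

/-- Averaging with the isometric `σ` is contractive and isolates the component `fixedHom a`, and
`fixedHom` is isometric. -/
theorem norm_fixedHom_le (a b : CuntzAlgebraTwo) :
    ‖a‖ ≤ ‖fixedHom a + flipUnitary * fixedHom b‖ := by
  have h : fixedHom a = (1 / 2 : ℂ) • (fixedHom a + flipUnitary * fixedHom b) +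
      (1 / 2 : ℂ) • σ (fixedHom a + flipUnitary * fixedHom b) := by
    rw [← smul_add, map_add, map_mul, σ_fixedHom, σ_fixedHom, σ_flipUnitary, neg_mul,
      show fixedHom a + flipUnitary * fixedHom b + (fixedHom a + -(flipUnitary * fixedHom b)) =
        fixedHom a + fixedHom a by abel, ← two_smul ℂ, smul_smul]
    norm_num
  generalize fixedHom a + flipUnitary * fixedHom b = x at h ⊢
  rw [← norm_fixedHom, h]
  refine (norm_add_le _ _).trans (le_of_eq ?_)
  rw [norm_smul, norm_smul, norm_σ, ← add_mul]
  norm_num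

end CuntzAlgebraTwo

/-! ### The generators of the crossed product -/

namespace CrossedProductInt

section

variable {A : Type u} [CStarAlgebra A] (α : A ≃⋆ₐ[ℂ] A)

/-- The canonical unitary of the crossed product. -/
def unit : CrossedProductInt A α := (crossedProductRelations A α).gen (Sum.inr PUnit.unit)

/-- The canonical copy of the coefficient algebra in the crossed product. -/
def coeff : A →⋆ₐ[ℂ] CrossedProductInt A α where
  toFun a := (crossedProductRelations A α).gen (Sum.inl a)
  map_one' := (crossedProductRelations A α).ext_coord fun i => by
    obtain ⟨π, U, hπ, -⟩ := ((crossedProductRelations A α).rep i).holds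
    simp only [map_one, CStarRelations.coord_incl_gen, hπ]
  map_mul' a b := (crossedProductRelations A α).ext_coord fun i => by
    obtain ⟨π, U, hπ, -⟩ := ((crossedProductRelations A α).rep i).holds
    simp only [map_mul, CStarRelations.coord_incl_gen, hπ]
  map_zero' := (crossedProductRelations A α).ext_coord fun i => by
    obtain ⟨π, U, hπ, -⟩ := ((crossedProductRelations A α).rep i).holds
    simp only [map_zero, CStarRelations.coord_incl_gen, hπ]
  map_add' a b := (crossedProductRelations A α).ext_coord fun i => by
    obtain ⟨π, U, hπ, -⟩ := ((crossedProductRelations A α).rep i).holds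
    simp only [map_add, CStarRelations.coord_incl_gen, hπ]
  commutes' c := (crossedProductRelations A α).ext_coord fun i => by
    obtain ⟨π, U, hπ, -⟩ := ((crossedProductRelations A α).rep i).holds
    simp only [AlgHomClass.commutes, CStarRelations.coord_incl_gen, hπ]
  map_star' a := (crossedProductRelations A α).ext_coord fun i => by
    obtain ⟨π, U, hπ, -⟩ := ((crossedProductRelations A α).rep i).holds
    simp only [map_star, CStarRelations.coord_incl_gen, hπ]

theorem unit_mem_unitary : unit α ∈ unitary (CrossedProductInt A α) := by
  constructor
  all_goals
    refine (crossedProductRelations A α).ext_coord fun i => ?_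
    obtain ⟨π, U, -, hU, hu, -⟩ := ((crossedProductRelations A α).rep i).holds
    simp only [map_mul, map_star, map_one, unit, CStarRelations.coord_incl_gen, hU]
  · exact hu.1
  · exact hu.2

theorem unit_mul_coeff_mul_star (a : A) :
    unit α * coeff α a * star (unit α) = coeff α (α a) := by
  refine (crossedProductRelations A α).ext_coord fun i => ?_
  obtain ⟨π, U, hπ, hU, -, h⟩ := ((crossedProductRelations A α).rep i).holds
  have h1 : ∀ b, (crossedProductRelations A α).coord i
      ((crossedProductRelations A α).incl (coeff α b)) = π b := hπ
  simp only [map_mul, map_star, h1, unit, CStarRelations.coord_incl_gen, hU, h]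

theorem unit_mul_coeff (a : A) : unit α * coeff α a = coeff α (α a) * unit α := by
  rw [← unit_mul_coeff_mul_star, mul_assoc, (unit_mem_unitary α).1, mul_one]

/-- The homomorphism from the crossed product given by a covariant pair. -/
def liftPair {B : Type u} [CStarAlgebra B] (π : A →⋆ₐ[ℂ] B) {U : B} (hU : U ∈ unitary B)
    (h : ∀ a, U * π a * star U = π (α a)) : CrossedProductInt A α →⋆ₐ[ℂ] B :=
  (crossedProductRelations A α).lift (Sum.elim π fun _ => U)
    ⟨π, U, fun _ => rfl, rfl, hU, h⟩

variable {α}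

theorem liftPair_coeff {B : Type u} [CStarAlgebra B] (π : A →⋆ₐ[ℂ] B) {U : B} (hU : U ∈ unitary B)
    (h : ∀ a, U * π a * star U = π (α a)) (a : A) : liftPair α π hU h (coeff α a) = π a :=
  (crossedProductRelations A α).lift_gen _ _ _

theorem liftPair_unit {B : Type u} [CStarAlgebra B] (π : A →⋆ₐ[ℂ] B) {U : B} (hU : U ∈ unitary B)
    (h : ∀ a, U * π a * star U = π (α a)) : liftPair α π hU h (unit α) = U :=
  (crossedProductRelations A α).lift_gen _ _ _

end

/-! ### Crossed products by automorphisms of order two -/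

section

variable {A : Type u} [CStarAlgebra A] {α : A ≃⋆ₐ[ℂ] A}

/-- The square of the canonical unitary. -/
def unitSq (α : A ≃⋆ₐ[ℂ] A) : CrossedProductInt A α := unit α * unit α

theorem unitSq_mem_unitary : unitSq α ∈ unitary (CrossedProductInt A α) :=
  mul_mem (unit_mem_unitary α) (unit_mem_unitary α)

theorem commute_unitSq_unit : Commute (unitSq α) (unit α) := by
  rw [commute_iff_eq, unitSq, mul_assoc]

theorem commute_star_of_commute {B : Type*} [CStarAlgebra B] {z b : B} (hz : z ∈ unitary B)
    (h : Commute z b) : Commute (star z) b := by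
  rw [commute_iff_eq]
  calc star z * b = star z * (b * z) * star z := by
        rw [mul_assoc, mul_assoc, hz.2, mul_one]
    _ = b * star z := by rw [← h.eq, ← mul_assoc, hz.1, one_mul]

theorem commute_unitSq_coeff (hα : ∀ a, α (α a) = a) (a : A) : Commute (unitSq α) (coeff α a) := by
  rw [commute_iff_eq, unitSq, mul_assoc, unit_mul_coeff, ← mul_assoc, unit_mul_coeff, hα, mul_assoc]

/-- The homomorphism into the crossed product from the algebra of continuous functions on the
circle with values in the coefficient algebra, sending the coordinate to the square of the
canonical unitary. -/
def circleHom (hα : ∀ a, α (α a) = a) :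
    C(Metric.sphere (0 : ℂ) 1, A) →⋆ₐ[ℂ] CrossedProductInt A α :=
  ContinuousMap.liftHom (unitaryCalculus unitSq_mem_unitary) (coeff α) fun g a =>
    commute_unitaryCalculus _ (commute_unitSq_coeff hα a)
      (commute_star_of_commute unitSq_mem_unitary (commute_unitSq_coeff hα a)) g

theorem circleHom_constHom (hα : ∀ a, α (α a) = a) (a : A) :
    circleHom hα (ContinuousMap.constHom _ A a) = coeff α a :=
  ContinuousMap.liftHom_constHom _ _ _ a

theorem circleHom_scalarHom (hα : ∀ a, α (α a) = a) (g : C(Metric.sphere (0 : ℂ) 1, ℂ)) :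
    circleHom hα (ContinuousMap.scalarHom _ A g) = unitaryCalculus unitSq_mem_unitary g :=
  ContinuousMap.liftHom_scalarHom _ _ _ g

theorem circleHom_circleCoord (hα : ∀ a, α (α a) = a) :
    circleHom hα (ContinuousMap.scalarHom _ A circleCoord) = unitSq α := by
  rw [circleHom_scalarHom, unitaryCalculus_circleCoord]

/-- Pointwise application of the automorphism. -/
def pointwise (α : A ≃⋆ₐ[ℂ] A) :
    C(Metric.sphere (0 : ℂ) 1, A) →⋆ₐ[ℂ] C(Metric.sphere (0 : ℂ) 1, A) :=
  ContinuousMap.compStarAlgHom _ (α : A →⋆ₐ[ℂ] A) (continuous_starAlgHom _)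

theorem unit_mul_circleHom (hα : ∀ a, α (α a) = a) (F : C(Metric.sphere (0 : ℂ) 1, A)) :
    unit α * circleHom hα F * star (unit α) = circleHom hα (pointwise α F) := by
  have h : (Unitary.conjStarAlgAut ℂ (CrossedProductInt A α) ⟨_, unit_mem_unitary α⟩ :
      CrossedProductInt A α →⋆ₐ[ℂ] CrossedProductInt A α).comp (circleHom hα) =
      (circleHom hα).comp (pointwise α) := by
    refine ContinuousMap.starAlgHom_ext_tensor (fun g => ?_) (fun a => ?_)
    · have hg : pointwise α (ContinuousMap.scalarHom _ A g) = ContinuousMap.scalarHom _ A g :=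
        ContinuousMap.ext fun x => AlgHomClass.commutes α (g x)
      change unit α * circleHom hα _ * star (unit α) = circleHom hα (pointwise α _)
      rw [hg, circleHom_scalarHom, ← (commute_unitaryCalculus _ commute_unitSq_unit
        (commute_star_of_commute unitSq_mem_unitary commute_unitSq_unit) g).eq, mul_assoc,
        (unit_mem_unitary α).2, mul_one]
    · change unit α * circleHom hα _ * star (unit α) =
        circleHom hα (ContinuousMap.constHom _ A (α a))
      rw [circleHom_constHom, circleHom_constHom, unit_mul_coeff_mul_star]
  exact DFunLike.congr_fun h F

theorem circleHom_mul_unit (hα : ∀ a, α (α a) = a) (F : C(Metric.sphere (0 : ℂ) 1, A)) :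
    circleHom hα F * unit α = unit α * circleHom hα (pointwise α F) := by
  have hF : pointwise α (pointwise α F) = F := ContinuousMap.ext fun x => hα (F x)
  have h := unit_mul_circleHom hα (pointwise α F)
  rw [hF] at h
  rw [← h, mul_assoc, (unit_mem_unitary α).1, mul_one]

/-- No other power of `U` is needed: `U²` and its adjoint lie in the range of `circleHom`, `U* = U
(U²)*`, and `U` normalizes that range. -/
theorem dense_circleHom_add (hα : ∀ a, α (α a) = a) :
    Dense {x | ∃ F G, x = circleHom hα F + unit α * circleHom hα G} := by
  let P : StarSubalgebra ℂ (CrossedProductInt A α) :=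
    (circleHom hα).range.adjoinNormalizer (unit α) ⟨_, circleHom_circleCoord hα⟩
      ⟨star (unitSq α), star_mem ⟨_, circleHom_circleCoord hα⟩, by
        rw [unitSq, star_mul, ← mul_assoc, (unit_mem_unitary α).2, one_mul]⟩
      (by
        rintro _ ⟨F, rfl⟩
        exact ⟨_, ⟨pointwise α F, rfl⟩, circleHom_mul_unit hα F⟩)
  have hP : Dense (P : Set (CrossedProductInt A α)) := by
    refine (crossedProductRelations A α).dense_of_gen_mem P ?_
    rintro (a | ⟨⟩)
    · exact ⟨_, ⟨_, circleHom_constHom hα a⟩, 0, zero_mem _, by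
        rw [mul_zero, add_zero]; rfl⟩
    · exact ⟨0, zero_mem _, 1, one_mem _, by rw [mul_one, zero_add]; rfl⟩
  refine hP.mono ?_
  rintro _ ⟨_, ⟨F, rfl⟩, _, ⟨G, rfl⟩, rfl⟩
  exact ⟨F, G, rfl⟩

end

end CrossedProductInt

/-! ### The interval as a double cover of the circle with its endpoints identified -/

/-- The function `exp (π i (t - 1) / 2)` on `[-1, 1]`. -/
def halfTurn : C(Set.Icc (-1 : ℝ) 1, ℂ) :=
  ⟨fun t => Complex.exp (((Real.pi * ((t : ℝ) - 1) / 2 : ℝ) : ℂ) * Complex.I), by fun_prop⟩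

theorem halfTurn_apply (t : Set.Icc (-1 : ℝ) 1) :
    halfTurn t = Complex.exp (((Real.pi * ((t : ℝ) - 1) / 2 : ℝ) : ℂ) * Complex.I) := rfl

theorem norm_halfTurn (t : Set.Icc (-1 : ℝ) 1) : ‖halfTurn t‖ = 1 :=
  Complex.norm_exp_ofReal_mul_I _

theorem star_halfTurn_mul (t : Set.Icc (-1 : ℝ) 1) : star (halfTurn t) * halfTurn t = 1 := by
  have h := Complex.conj_mul' (halfTurn t)
  rw [norm_halfTurn] at h
  simpa using h

theorem halfTurn_rightEnd : halfTurn CuntzAlgebraTwo.rightEnd = 1 := by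
  simp [halfTurn_apply, CuntzAlgebraTwo.rightEnd]

theorem halfTurn_leftEnd : halfTurn CuntzAlgebraTwo.leftEnd = -1 := by
  rw [halfTurn_apply, CuntzAlgebraTwo.leftEnd,
    show Real.pi * (-1 - 1) / 2 = -Real.pi by ring, Complex.ofReal_neg, neg_mul,
    Complex.exp_neg, Complex.exp_pi_mul_I]
  norm_num

/-- The map `t ↦ exp (π i (t - 1))` from `[-1, 1]` onto the unit circle. -/
def fullTurn : C(Set.Icc (-1 : ℝ) 1, Metric.sphere (0 : ℂ) 1) :=
  ⟨fun t => ⟨halfTurn t * halfTurn t, by simp [norm_halfTurn]⟩, by fun_prop⟩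

theorem fullTurn_eq (t : Set.Icc (-1 : ℝ) 1) :
    (fullTurn t : ℂ) = Complex.exp (((Real.pi * ((t : ℝ) - 1) : ℝ) : ℂ) * Complex.I) := by
  change halfTurn t * halfTurn t = _
  rw [halfTurn_apply, ← Complex.exp_add]
  congr 1
  push_cast
  ring

theorem fullTurn_surjective : Function.Surjective fullTurn := by
  rintro ⟨w, hw⟩
  have hw1 : ‖w‖ = 1 := by simpa using hw
  have hexp : Complex.exp ((w.arg : ℂ) * Complex.I) = w := by
    have := Complex.norm_mul_exp_arg_mul_I w
    rwa [hw1, Complex.ofReal_one, one_mul] at this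
  have hpi := Real.pi_pos
  -- As `t` runs over `[-1, 1]` the angle `π(t - 1)` runs over `[-2π, 0]`, so a positive principal
  -- argument must be lowered by `2π`.
  have key : ∀ θ : ℝ, -(2 * Real.pi) ≤ θ → θ ≤ 0 → Complex.exp ((θ : ℂ) * Complex.I) = w →
      ∃ t, fullTurn t = ⟨w, hw⟩ := fun θ h1 h2 h3 => by
    refine ⟨⟨1 + θ / Real.pi, ?_, ?_⟩, Subtype.ext ?_⟩
    · have : -2 ≤ θ / Real.pi := by rw [le_div_iff₀ hpi]; linarith
      linarith
    · have : θ / Real.pi ≤ 0 := div_nonpos_of_nonpos_of_nonneg h2 hpi.le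
      linarith
    · rw [fullTurn_eq]
      change Complex.exp (((Real.pi * (1 + θ / Real.pi - 1) : ℝ) : ℂ) * Complex.I) = w
      rw [show Real.pi * (1 + θ / Real.pi - 1) = θ by field_simp; ring, h3]
  rcases le_or_gt w.arg 0 with h | h
  · exact key w.arg (by linarith [Complex.neg_pi_lt_arg w]) h hexp
  · refine key (w.arg - 2 * Real.pi) (by linarith) (by linarith [Complex.arg_le_pi w]) ?_
    rw [← hexp, Complex.exp_eq_exp_iff_exists_int]
    refine ⟨-1, ?_⟩
    rw [hexp]
    push_cast
    ring

theorem eq_of_fullTurn_eq {t s : Set.Icc (-1 : ℝ) 1} (h : fullTurn t = fullTurn s) :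
    t = s ∨ (t = CuntzAlgebraTwo.leftEnd ∧ s = CuntzAlgebraTwo.rightEnd) ∨
      (t = CuntzAlgebraTwo.rightEnd ∧ s = CuntzAlgebraTwo.leftEnd) := by
  have h1 := congrArg (Subtype.val) h
  rw [fullTurn_eq, fullTurn_eq, Complex.exp_eq_exp_iff_exists_int] at h1
  obtain ⟨n, hn⟩ := h1
  have h2 : Real.pi * ((t : ℝ) - 1) = Real.pi * ((s : ℝ) - 1) + n * (2 * Real.pi) := by
    have h3 := congrArg Complex.im hn
    simpa using h3
  have h3 : (t : ℝ) = s + 2 * n := by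
    have h4 : Real.pi * ((t : ℝ) - (s + 2 * n)) = 0 := by linear_combination h2
    rcases mul_eq_zero.1 h4 with h5 | h5
    · exact absurd h5 Real.pi_ne_zero
    · linarith
  obtain ⟨ht1, ht2⟩ := t.2
  obtain ⟨hs1, hs2⟩ := s.2
  have hn1 : n < 2 := by
    have : (n : ℝ) < 2 := by linarith
    exact_mod_cast this
  have hn2 : -2 < n := by
    have : (-2 : ℝ) < n := by linarith
    exact_mod_cast this
  obtain rfl | rfl | rfl : n = -1 ∨ n = 0 ∨ n = 1 := by omega
  · right; left
    push_cast at h3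
    exact ⟨Subtype.ext (by change (t : ℝ) = -1; linarith),
      Subtype.ext (by change (s : ℝ) = 1; linarith)⟩
  · left
    push_cast at h3
    exact Subtype.ext (by linarith)
  · right; right
    push_cast at h3
    exact ⟨Subtype.ext (by change (t : ℝ) = 1; linarith),
      Subtype.ext (by change (s : ℝ) = -1; linarith)⟩

/-- A continuous surjection from a compact space to a Hausdorff one is a quotient map, and
`fullTurn` identifies only the two endpoints. -/
theorem exists_comp_fullTurn {Z : Type*} [TopologicalSpace Z] (g : C(Set.Icc (-1 : ℝ) 1, Z))
    (hg : g CuntzAlgebraTwo.leftEnd = g CuntzAlgebraTwo.rightEnd) :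
    ∃ G : C(Metric.sphere (0 : ℂ) 1, Z), ∀ t, G (fullTurn t) = g t := by
  have hq : Topology.IsQuotientMap fullTurn :=
    Topology.IsQuotientMap.of_surjective_continuous fullTurn_surjective fullTurn.continuous
  have hfac : Function.FactorsThrough g fullTurn := fun t s hts => by
    rcases eq_of_fullTurn_eq hts with rfl | ⟨rfl, rfl⟩ | ⟨rfl, rfl⟩
    · rfl
    · exact hg
    · exact hg.symm
  refine ⟨Topology.IsQuotientMap.lift (f := fullTurn) hq g hfac, fun t => ?_⟩
  exact DFunLike.congr_fun (Topology.IsQuotientMap.lift_comp (f := fullTurn) hq g hfac) t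

/-! ### The isomorphism -/

namespace CuntzAlgebraTwo

open ContinuousMap CrossedProductInt

/-- The image of the canonical unitary in the functions on the interval. -/
def twistedUnit : C(Set.Icc (-1 : ℝ) 1, CuntzAlgebraTwo) :=
  scalarHom _ _ halfTurn * constHom _ _ flipUnitary

theorem twistedUnit_apply (t : Set.Icc (-1 : ℝ) 1) :
    twistedUnit t = halfTurn t • flipUnitary :=
  (Algebra.smul_def (halfTurn t) flipUnitary).symm

theorem twistedUnit_mem_unitary :
    twistedUnit ∈ unitary C(Set.Icc (-1 : ℝ) 1, CuntzAlgebraTwo) := by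
  constructor
  all_goals
    ext t
    rw [mul_apply, star_apply, twistedUnit_apply, star_smul, star_flipUnitary, smul_mul_smul_comm,
      flipUnitary_mul_self, one_apply]
  · rw [star_halfTurn_mul, one_smul]
  · rw [mul_comm, star_halfTurn_mul, one_smul]

theorem twistedUnit_covariant (a : CuntzAlgebraTwo) :
    twistedUnit * (constHom _ _).comp fixedHom a * star twistedUnit =
      (constHom (Set.Icc (-1 : ℝ) 1) CuntzAlgebraTwo).comp fixedHom (σ a) := by
  ext t
  change twistedUnit t * fixedHom a * star (twistedUnit t) = fixedHom (σ a)
  rw [twistedUnit_apply, star_smul, star_flipUnitary, smul_mul_assoc, smul_mul_smul_comm, mul_comm,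
    star_halfTurn_mul, one_smul, flipUnitary_mul_fixedHom]

/-- The homomorphism from the crossed product to the functions on the interval. -/
def toFunctions :
    CrossedProductInt CuntzAlgebraTwo σ →⋆ₐ[ℂ] C(Set.Icc (-1 : ℝ) 1, CuntzAlgebraTwo) :=
  liftPair σ ((constHom _ _).comp fixedHom) twistedUnit_mem_unitary twistedUnit_covariant

theorem toFunctions_unit : toFunctions (unit σ) = twistedUnit := liftPair_unit _ _ _

theorem toFunctions_coeff (a : CuntzAlgebraTwo) :
    toFunctions (coeff σ a) = constHom _ _ (fixedHom a) := liftPair_coeff _ _ _ a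

theorem toFunctions_unitSq :
    toFunctions (unitSq σ) = scalarHom _ _ (circleCoord.comp fullTurn) := by
  rw [unitSq, map_mul, toFunctions_unit]
  ext t
  rw [mul_apply, twistedUnit_apply, smul_mul_smul_comm, flipUnitary_mul_self, scalarHom_apply,
    Algebra.algebraMap_eq_smul_one]
  rfl

/-- Both sides are homomorphisms in `F`, so scalar and constant functions suffice; the scalar case
reduces to the coordinate, where `U²` goes to `h² u² = h²`. -/
theorem toFunctions_circleHom (F : C(Metric.sphere (0 : ℂ) 1, CuntzAlgebraTwo))
    (t : Set.Icc (-1 : ℝ) 1) :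
    toFunctions (circleHom σ_σ F) t = fixedHom (F (fullTurn t)) := by
  have h1 : toFunctions.comp (unitaryCalculus (unitSq_mem_unitary (α := σ))) =
      (scalarHom _ CuntzAlgebraTwo).comp (compStarAlgHom' ℂ ℂ fullTurn) := by
    refine starAlgHom_ext_circleCoord ?_
    change toFunctions (unitaryCalculus unitSq_mem_unitary circleCoord) = scalarHom _ _ (circleCoord.comp fullTurn)
    rw [unitaryCalculus_circleCoord, toFunctions_unitSq]
  have h2 : toFunctions.comp (circleHom σ_σ) =
      (compStarAlgHom _ fixedHom (continuous_starAlgHom _)).comp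
        (compStarAlgHom' ℂ CuntzAlgebraTwo fullTurn) := by
    refine starAlgHom_ext_tensor (fun g => ?_) (fun a => ?_)
    · change toFunctions (circleHom σ_σ _) = _
      rw [circleHom_scalarHom]
      refine (DFunLike.congr_fun h1 g).trans (ContinuousMap.ext fun s => ?_)
      exact (AlgHomClass.commutes fixedHom (g (fullTurn s))).symm
    · change toFunctions (circleHom σ_σ _) = _
      rw [circleHom_constHom, toFunctions_coeff]
      rfl
  exact DFunLike.congr_fun (DFunLike.congr_fun h2 F) t

theorem toFunctions_add_apply (F G : C(Metric.sphere (0 : ℂ) 1, CuntzAlgebraTwo))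
    (t : Set.Icc (-1 : ℝ) 1) :
    toFunctions (circleHom σ_σ F + unit σ * circleHom σ_σ G) t =
      fixedHom (F (fullTurn t)) + halfTurn t • (flipUnitary * fixedHom (G (fullTurn t))) := by
  rw [map_add, map_mul, ContinuousMap.add_apply, mul_apply, toFunctions_circleHom,
    toFunctions_circleHom, toFunctions_unit, twistedUnit_apply, smul_mul_assoc]

theorem norm_le_toFunctions (x : CrossedProductInt CuntzAlgebraTwo σ) :
    ‖x‖ ≤ 2 * ‖toFunctions x‖ := by
  have hcont : Continuous toFunctions := continuous_starAlgHom toFunctions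
  refine (dense_circleHom_add σ_σ).induction
    (P := fun x : CrossedProductInt CuntzAlgebraTwo σ => ‖x‖ ≤ 2 * ‖toFunctions x‖) ?_
    (isClosed_le (by fun_prop) (by fun_prop)) x
  rintro _ ⟨F, G, rfl⟩
  set f := toFunctions (circleHom σ_σ F + unit σ * circleHom σ_σ G) with hf
  have hF : ‖F‖ ≤ ‖f‖ := by
    rw [ContinuousMap.norm_le _ (norm_nonneg _)]
    intro s
    obtain ⟨t, rfl⟩ := fullTurn_surjective s
    refine le_trans ?_ (f.norm_coe_le_norm t)
    rw [hf, toFunctions_add_apply, ← mul_smul_comm, ← map_smul]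
    exact norm_fixedHom_le _ _
  have hG : ‖G‖ ≤ ‖f‖ := by
    rw [ContinuousMap.norm_le _ (norm_nonneg _)]
    intro s
    obtain ⟨t, rfl⟩ := fullTurn_surjective s
    refine le_trans ?_ (f.norm_coe_le_norm t)
    -- Multiplication by the unitary `u` exchanges the roles of the two components without changing
    -- the norm.
    have h1 : flipUnitary * f t = fixedHom (halfTurn t • G (fullTurn t)) +
        flipUnitary * fixedHom (F (fullTurn t)) := by
      rw [hf, toFunctions_add_apply, mul_add, mul_smul_comm, flipUnitary_mul_mul_self, map_smul,
        add_comm]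
    have h2 := norm_fixedHom_le (halfTurn t • G (fullTurn t)) (F (fullTurn t))
    rwa [← h1, norm_smul, norm_halfTurn, one_mul,
      CStarRing.norm_mem_unitary_mul _ flipUnitary_mem_unitary] at h2
  calc ‖circleHom σ_σ F + unit σ * circleHom σ_σ G‖
      ≤ ‖circleHom σ_σ F‖ + ‖unit σ * circleHom σ_σ G‖ := norm_add_le _ _
    _ ≤ ‖F‖ + ‖G‖ := by
        rw [CStarRing.norm_mem_unitary_mul _ (unit_mem_unitary σ)]
        exact add_le_add (NonUnitalStarAlgHom.norm_apply_le _ _)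
          (NonUnitalStarAlgHom.norm_apply_le _ _)
    _ ≤ 2 * ‖f‖ := by linarith

theorem toFunctions_injective : Function.Injective toFunctions := by
  rw [injective_iff_map_eq_zero]
  intro x hx
  have h := norm_le_toFunctions x
  rw [hx, norm_zero, mul_zero] at h
  exact norm_le_zero_iff.1 h

theorem mem_endpointAlgebra_iff (f : C(Set.Icc (-1 : ℝ) 1, CuntzAlgebraTwo)) :
    f ∈ endpointAlgebra ↔ f leftEnd = σ (f rightEnd) := endpoint_iff _ _

theorem toFunctions_mem (x : CrossedProductInt CuntzAlgebraTwo σ) :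
    toFunctions x ∈ endpointAlgebra := by
  have hcont : Continuous toFunctions := continuous_starAlgHom toFunctions
  have hσ := continuous_σ
  have hturn : fullTurn leftEnd = fullTurn rightEnd := Subtype.ext <| by
    change halfTurn leftEnd * halfTurn leftEnd = halfTurn rightEnd * halfTurn rightEnd
    rw [halfTurn_leftEnd, halfTurn_rightEnd]
    norm_num
  rw [mem_endpointAlgebra_iff]
  refine (dense_circleHom_add σ_σ).induction (P := fun x : CrossedProductInt CuntzAlgebraTwo σ =>
    toFunctions x leftEnd = σ (toFunctions x rightEnd)) ?_
    (isClosed_eq (by fun_prop) (by fun_prop)) x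
  rintro _ ⟨F, G, rfl⟩
  rw [toFunctions_add_apply, toFunctions_add_apply, halfTurn_leftEnd, halfTurn_rightEnd, hturn,
    map_add, one_smul, map_mul, σ_fixedHom, σ_fixedHom, σ_flipUnitary, neg_smul, one_smul, neg_mul]

/-- Descend `g` to the circle first, then take pointwise preimages under `fixedHom`; they vary
continuously because `fixedHom` is a topological embedding. -/
theorem exists_circle_fixedHom (g : C(Set.Icc (-1 : ℝ) 1, CuntzAlgebraTwo))
    (hg : ∀ t, σ (g t) = g t) (hend : g leftEnd = g rightEnd) :
    ∃ F : C(Metric.sphere (0 : ℂ) 1, CuntzAlgebraTwo), ∀ t, fixedHom (F (fullTurn t)) = g t := by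
  obtain ⟨G, hG⟩ := exists_comp_fullTurn g hend
  have hG' : ∀ s, ∃ a, fixedHom a = G s := fun s => by
    obtain ⟨t, rfl⟩ := fullTurn_surjective s
    rw [hG]
    exact exists_fixedHom_eq _ (hg t)
  choose F hF using hG'
  have hcont : Continuous F := by
    rw [(NonUnitalStarAlgHom.isometry fixedHom fixedHom_injective).isEmbedding.continuous_iff]
    exact G.continuous.congr fun s => (hF s).symm
  exact ⟨⟨F, hcont⟩, fun t => (hF _).trans (hG t)⟩

theorem exists_toFunctions_eq {f : C(Set.Icc (-1 : ℝ) 1, CuntzAlgebraTwo)}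
    (hf : f ∈ endpointAlgebra) : ∃ x, toFunctions x = f := by
  rw [mem_endpointAlgebra_iff] at hf
  have hσ := continuous_σ
  have hf' : σ (f leftEnd) = f rightEnd := by rw [hf, σ_σ]
  obtain ⟨F, hF⟩ := exists_circle_fixedHom
    ⟨fun t => (1 / 2 : ℂ) • (f t + σ (f t)), by fun_prop⟩
    (fun t => by
      change σ ((1 / 2 : ℂ) • (f t + σ (f t))) = (1 / 2 : ℂ) • (f t + σ (f t))
      rw [map_smul, map_add, σ_σ, add_comm])
    (by
      change (1 / 2 : ℂ) • (f leftEnd + σ (f leftEnd)) = (1 / 2 : ℂ) • (f rightEnd + σ (f rightEnd))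
      rw [hf', hf, add_comm])
  -- The factor `u` turns the odd part into a `σ`-fixed function. At the endpoints the odd part
  -- takes opposite values, and the sign of `star (halfTurn t)` compensates.
  obtain ⟨G, hG⟩ := exists_circle_fixedHom
    ⟨fun t => star (halfTurn t) • (1 / 2 : ℂ) • (flipUnitary * (f t - σ (f t))), by fun_prop⟩
    (fun t => by
      change σ (star (halfTurn t) • (1 / 2 : ℂ) • (flipUnitary * (f t - σ (f t)))) =
        star (halfTurn t) • (1 / 2 : ℂ) • (flipUnitary * (f t - σ (f t)))
      rw [map_smul, map_smul, map_mul, map_sub, σ_σ, σ_flipUnitary, neg_mul, ← mul_neg, neg_sub])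
    (by
      change star (halfTurn leftEnd) • (1 / 2 : ℂ) • (flipUnitary * (f leftEnd - σ (f leftEnd))) =
        star (halfTurn rightEnd) • (1 / 2 : ℂ) • (flipUnitary * (f rightEnd - σ (f rightEnd)))
      rw [hf', hf, halfTurn_leftEnd, halfTurn_rightEnd, star_neg, star_one, neg_smul, ← smul_neg,
        ← smul_neg, ← mul_neg, neg_sub])
  refine ⟨circleHom σ_σ F + unit σ * circleHom σ_σ G, ContinuousMap.ext fun t => ?_⟩
  rw [toFunctions_add_apply, hF, hG]
  change (1 / 2 : ℂ) • (f t + σ (f t)) + halfTurn t • (flipUnitary * (star (halfTurn t) •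
    (1 / 2 : ℂ) • (flipUnitary * (f t - σ (f t))))) = f t
  rw [mul_smul_comm, mul_smul_comm, flipUnitary_mul_mul_self, smul_smul, mul_comm (halfTurn t),
    star_halfTurn_mul, one_smul, ← smul_add,
    show f t + σ (f t) + (f t - σ (f t)) = f t + f t by abel, ← two_smul ℂ, smul_smul]
  norm_num

end CuntzAlgebraTwo

end

theorem mainTheorem8 :
    Nonempty (CrossedProductInt CuntzAlgebraTwo CuntzAlgebraTwo.σ ≃⋆ₐ[ℂ]
      CuntzAlgebraTwo.endpointAlgebra) := by
  refine ⟨StarAlgEquiv.ofBijective (CuntzAlgebraTwo.toFunctions.codRestrict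
    CuntzAlgebraTwo.endpointAlgebra CuntzAlgebraTwo.toFunctions_mem) ⟨?_, ?_⟩⟩
  · exact (StarAlgHom.injective_codRestrict _ _ _).2 CuntzAlgebraTwo.toFunctions_injective
  · rintro ⟨f, hf⟩
    obtain ⟨x, hx⟩ := CuntzAlgebraTwo.exists_toFunctions_eq hf
    exact ⟨x, Subtype.ext hx⟩
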